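/- **Setting.** Let $n\ge 1$, let $\mathrm{Prob}$ be a probability measure on a measurable space $\mathbb{Q}$, let $\Theta\subset\mathbb{R}^n$ be convex and compact, $c\in\mathbb{R}^n$, and let $f:\mathbb{R}^n\times\mathbb{Q}\to\mathbb{R}$ be convex in $\theta$ for each $q$ and measurable in $q$ for each $\theta$. Put $V(\theta)=\mathrm{Prob}\{q: f(\theta,q)>0\}$. For i.i.d. samples $\omega=(q^{(1)},\dots,q^{(M)})$ from $\mathrm{Prob}$ the scenario problem is $$\min_{\theta\in\Theta} c^\top\theta\quad\text{s.t. } f(\theta,q^{(i)})\le 0,\ i=1,\dots,M ,$$ with optimal solution $\theta^*(\omega)$ and optimal value $J^*$. Constraint $j$ is a *support constraint* if the optimal value $J^*_j$ of the problem without constraint $j$ satisfies $J^*_j<J^*$. The problem with $M$ samples is *uniquely solvable* if almost surely it is feasible and has exactly one optimal solution, and it is *fully supported w.p. 1* if almost surely it has exactly $n$ support constraints. **Algorithm.** Let $N_o\ge1$ and $\epsilon'\in[0,1]$. At each iteration $k=1,2,\dots$: draw $N$ fresh i.i.d. samples from $\mathrm{Prob}$ and let $\theta^*_k$ be the solution of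 the resulting scenario problem; draw $N_o$ further i.i.d. samples $q^{(1)},\dots,q^{(N_o)}$ from $\mathrm{Prob}$, and set the flag to true if $\#\{i: f(\theta^*_k,q^{(i)})>0\}\le \epsilon' N_o$ and to false otherwise; if the flag is true, exit and return $\theta^*_k$, else go to iteration $k+1$. All samples of all iterations are independent; $\mathrm{Prob}^{\times\times}$ is their joint law. The running time $K\in\{1,2,\dots,\infty\}$ is the iteration at which the algorithm exits, and $\mathrm{BadExit}$ is the event that it exits and returns some $\theta^*$ with $V(\theta^*)>\epsilon$. **Notation.** $B(\alpha,\beta)=\Gamma(\alpha)\Gamma(\beta)/\Gamma(\alpha+\beta)$, $\ \mathrm{Fbeta}(\alpha,\beta;t)=\int_0^t \frac{x^{\alpha-1}(1-x)^{\beta-1}}{B(\alpha,\beta)}\,dx$ (read as $0$ when $t=0$), and $$\beta_\epsilon(N)=1-\sum_{i=n}^N\binom Ni\epsilon^i(1-\epsilon)^{N-i},$$ $$H_{1,\epsilon'}(N,N_o)=1-\sum_{i=0}^{\lfloor \epsilon' N_o\rfloor}\binom{N_o}{i}\frac{B(i+n,\,N_o-i+N-n+1)}{B(n,\,N+1-n)},$$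 $$\bar\beta_{\epsilon,\epsilon'}(N,N_o)=\mathrm{Fbeta}\big(N+(1-\epsilon')N_o-n+1,\ n+\epsilon' N_o;\ 1-\epsilon\big).$$ **Theorem.** Let $0\le\epsilon'\le\epsilon\le1$, $N\ge n$ and $N_o\ge 1$. Assume that the scenario problem with $N$ samples is uniquely solvable and, if $N=n$, that the one with $n+1$ samples is uniquely solvable too. Then $\mathrm{BadExit}$ and $K$ are measurable up to null sets, and, "f.s." meaning that the scenario problem with $N$ samples (and, if $N=n$, also the one with $n+1$ samples) is fully supported w.p. 1: 1. $$\mathrm{Prob}^{\times\times}\{\mathrm{BadExit}\}\le\frac{\mathrm{Fbeta}((1-\epsilon')N_o,\ \epsilon' N_o+1;\ 1-\epsilon)}{1-H_{1,\epsilon'}(N,N_o)}\,\beta_\epsilon(N),$$ and if f.s., then $\mathrm{Prob}^{\times\times}\{\mathrm{BadExit}\}\le\bar\beta_{\epsilon,\epsilon'}(N,N_o)$. 2. $\mathbb{E}\{K\}\le (1-H_{1,\epsilon'}(N,N_o))^{-1}$, with equality if f.s. 3. For every integer $k\ge 0$, $\mathrm{Prob}^{\times\times}\{K\le k\}\ge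 1-H_{1,\epsilon'}(N,N_o)^k$, with equality if f.s. -/

import Mathlib

open MeasureTheory Set
open scoped ENNReal

/-! ### Beta and beta-binomial quantities -/

/-- Cumulative distribution function of the beta distribution with parameters `a`, `b`:
the integral over `[0, t]` of the density `x ^ (a - 1) * (1 - x) ^ (b - 1) / B(a, b)`. -/
noncomputable def Fbeta (a b t : ℝ) : ℝ :=
  ∫ x in (0 : ℝ)..t, ProbabilityTheory.betaPDFReal a b x

/-- Probability mass function of the beta-binomial distribution. -/
noncomputable def betaBinomial (d : ℕ) (a b : ℝ) (i : ℕ) : ℝ :=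
  (d.choose i : ℝ) * (ProbabilityTheory.beta (i + a) (d - i + b) / ProbabilityTheory.beta a b)

/-- `β_ε(N)`, for a problem with `n` decision variables. -/
noncomputable def betaTail (n : ℕ) (ε : ℝ) (N : ℕ) : ℝ :=
  1 - ∑ i ∈ Finset.Icc n N, (N.choose i : ℝ) * ε ^ i * (1 - ε) ^ (N - i)

/-- `H_{1,ε'}(N, N_o)`, for a problem with `n` decision variables. -/
noncomputable def Hone (n : ℕ) (ε' : ℝ) (N No : ℕ) : ℝ :=
  1 - ∑ i ∈ Finset.range (⌊ε' * No⌋₊ + 1), betaBinomial No n (N + 1 - n) i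

/-- `β̄_{ε,ε'}(N, N_o)`, for a problem with `n` decision variables. -/
noncomputable def betaBar (n : ℕ) (ε ε' : ℝ) (N No : ℕ) : ℝ :=
  Fbeta (N + (1 - ε') * No - n + 1) (n + ε' * No) (1 - ε)

/-! ### Scenario problems -/

/-- Data of a scenario design problem: domain `dom`, cost vector `cost`, and spec function
`spec θ q`. -/
structure ScenarioData (n : ℕ) (Q : Type*) where
  dom : Set (EuclideanSpace ℝ (Fin n))
  cost : EuclideanSpace ℝ (Fin n)
  spec : EuclideanSpace ℝ (Fin n) → Q → ℝ

namespace ScenarioData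

variable {n : ℕ} {Q : Type*}

/-- The standing assumptions on the data: the domain is convex and compact, the spec function is
convex in the design variable and measurable in the uncertainty. -/
structure Standing [MeasurableSpace Q] (p : ScenarioData n Q) : Prop where
  convex_dom : Convex ℝ p.dom
  compact_dom : IsCompact p.dom
  convex_spec : ∀ q, ConvexOn ℝ univ (fun θ => p.spec θ q)
  measurable_spec : ∀ θ, Measurable (p.spec θ)

/-- The linear objective. -/
noncomputable def obj (p : ScenarioData n Q) (θ : EuclideanSpace ℝ (Fin n)) : ℝ :=
  inner ℝ p.cost θ

/-- Points of the domain that satisfy the sampled constraints with index in `I`. -/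
def feasible (p : ScenarioData n Q) {M : ℕ} (ω : Fin M → Q) (I : Finset (Fin M)) :
    Set (EuclideanSpace ℝ (Fin n)) :=
  {θ | θ ∈ p.dom ∧ ∀ i ∈ I, p.spec θ (ω i) ≤ 0}

/-- `θ` is an optimal solution of the scenario problem built on the samples `ω`. -/
def IsOptimal (p : ScenarioData n Q) {M : ℕ} (ω : Fin M → Q)
    (θ : EuclideanSpace ℝ (Fin n)) : Prop :=
  θ ∈ p.feasible ω Finset.univ ∧ ∀ η ∈ p.feasible ω Finset.univ, p.obj θ ≤ p.obj η

/-- Optimal value of the problem that keeps only the constraints with index in `I`. -/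
noncomputable def optValue (p : ScenarioData n Q) {M : ℕ} (ω : Fin M → Q)
    (I : Finset (Fin M)) : ℝ :=
  sInf (p.obj '' p.feasible ω I)

/-- Constraint `j` is a support constraint: its removal lowers the optimal value. -/
def IsSupport (p : ScenarioData n Q) {M : ℕ} (ω : Fin M → Q) (j : Fin M) : Prop :=
  p.optValue ω (Finset.univ.erase j) < p.optValue ω Finset.univ

open Classical in
/-- The optimal solution `θ*(ω)` of the scenario problem (`0` if there is none). -/
noncomputable def solution (p : ScenarioData n Q) {M : ℕ} (ω : Fin M → Q) :
    EuclideanSpace ℝ (Fin n) :=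
  if h : ∃ θ, p.IsOptimal ω θ then h.choose else 0

section Prob

variable [MeasurableSpace Q]

/-- Almost surely, the scenario problem with `M` i.i.d. samples is feasible and attains a unique
optimal solution. -/
def UniquelySolvable (p : ScenarioData n Q) (μ : Measure Q) (M : ℕ) : Prop :=
  ∀ᵐ ω ∂(Measure.pi fun _ : Fin M => μ), ∃! θ, p.IsOptimal ω θ

/-- Almost surely, the scenario problem with `M` i.i.d. samples has exactly `n` support
constraints. -/
def FullySupported (p : ScenarioData n Q) (μ : Measure Q) (M : ℕ) : Prop :=
  ∀ᵐ ω ∂(Measure.pi fun _ : Fin M => μ), {j | p.IsSupport ω j}.ncard = n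

/-- Probability of violation of a design `θ`. -/
noncomputable def violation (p : ScenarioData n Q) (μ : Measure Q)
    (θ : EuclideanSpace ℝ (Fin n)) : ℝ :=
  μ.real {q | 0 < p.spec θ q}

end Prob

/-! ### Repetitive scenario design with the randomized violation oracle -/

/-- The randomized `ε'`-violation oracle returns true at `θ` on the samples `s`. -/
def OracleTrue (p : ScenarioData n Q) (ε' : ℝ) {No : ℕ} (θ : EuclideanSpace ℝ (Fin n))
    (s : Fin No → Q) : Prop :=
  ({i | 0 < p.spec θ (s i)}.ncard : ℝ) ≤ ε' * No

/-- All the randomness of the algorithm: `x k` holds the `N` scenarios and the `No` oracle samples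
that are used at iteration `k + 1`. -/
abbrev Runs (Q : Type*) (N No : ℕ) : Type _ := ℕ → (Fin N → Q) × (Fin No → Q)

/-- The law of the samples: every scenario and every oracle sample of every iteration is drawn
independently from `μ`. -/
noncomputable def runLaw [MeasurableSpace Q] (μ : Measure Q) [IsProbabilityMeasure μ]
    (N No : ℕ) : Measure (Runs Q N No) :=
  Measure.infinitePi fun _ : ℕ =>
    (Measure.pi fun _ : Fin N => μ).prod (Measure.pi fun _ : Fin No => μ)

variable {N No : ℕ}

/-- The solution computed in the scenario step of iteration `k + 1`. -/
noncomputable def iterate (p : ScenarioData n Q) (x : Runs Q N No) (k : ℕ) :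
    EuclideanSpace ℝ (Fin n) :=
  p.solution (x k).1

/-- The flag of iteration `k + 1` is true. -/
def Flag (p : ScenarioData n Q) (ε' : ℝ) (x : Runs Q N No) (k : ℕ) : Prop :=
  p.OracleTrue ε' (p.iterate x k) (x k).2

/-- The algorithm exits at iteration `k + 1`, that is, at the first iteration with a true flag. -/
def ExitsAt (p : ScenarioData n Q) (ε' : ℝ) (x : Runs Q N No) (k : ℕ) : Prop :=
  p.Flag ε' x k ∧ ∀ j < k, ¬ p.Flag ε' x j

/-- The running time: the value of the iteration counter at exit, `⊤` if the algorithm never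
exits. -/
noncomputable def runningTime (p : ScenarioData n Q) (ε' : ℝ) (x : Runs Q N No) : ℕ∞ :=
  ⨅ (k : ℕ) (_ : p.ExitsAt ε' x k), ((k + 1 : ℕ) : ℕ∞)

/-- The algorithm exits and returns a solution whose probability of violation exceeds `ε`. -/
def BadExit [MeasurableSpace Q] (p : ScenarioData n Q) (μ : Measure Q) (ε ε' : ℝ) (N No : ℕ) :
    Set (Runs Q N No) :=
  {x | ∃ k, p.ExitsAt ε' x k ∧ ε < p.violation μ (p.iterate x k)}

end ScenarioData

/-! For a sampled program let `keep` be the probability that one fresh constraint leaves the optimal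
value unchanged; when the optimum is unique this is `1 - V(θ*)`. The theorem rests on comparing the
law of `keep` for `N` samples with the beta distribution with parameters `N + 1 - n` and `n`: it is
always stochastically larger, and it is equal in the fully supported case.

The engine is an identity obtained by integrating out one sample at a time
(`lintegral_mul_sub_numSupp`, `lintegral_mul_keep`): the last of `M + 1` samples leaves the value
unchanged exactly when it is not a support constraint. If minimisers are unique and ties among
constraints are null, inserting such a constraint changes neither `keep` nor the number `k` of
support constraints, and iteration gives mixed moments of the two (`lintegral_keep_pow_mul_moment`).
They say that `keep`, multiplied by an independent beta variable with parameters `M + 1 - n` and `n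
- k`, has the moments of the target beta law. Since `k ≤ n` by Helly and the extra factor is at most
`1`, domination follows (`Nondegenerate.measure_keep_lt_le`).

An arbitrary program is perturbed by a strictly convex term and by random relaxations of its
constraints. This makes it nondegenerate, and the distribution bound survives the limit
(`measure_keep_lt_le`).

If the program with `M + 1` samples is fully supported, the same identity computes the mean of
`keep` for `M` samples. It is the beta mean, and stochastically ordered laws with equal means
coincide (`keepLaw_eq_of_succ`). A further use of the identity carries the law from `M` to `M + 1`
samples (`keepLaw_succ_eq`).

Given the scenarios, the number of violating oracle samples is binomial, so the exit probability of
one iteration, and its part with `V > ε`, are integrals of a binomial distribution function against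
the law of `keep` (`measure_exitSet_inter`). Monotonicity of beta distributions in their parameters
bounds these integrals. Iterations are independent, so the running time is geometric and the
probability of a bad exit is a quotient of two one-iteration probabilities (`measure_hit`). -/

open ProbabilityTheory

/-! ### Convex programs, optimal values and support constraints -/

/-- A convex program over a compact domain whose constraints are indexed by `Z`. -/
structure ConvexProgram (n : ℕ) (Z : Type*) [MeasurableSpace Z] where
  dom : Set (EuclideanSpace ℝ (Fin n))
  obj : EuclideanSpace ℝ (Fin n) → ℝ
  spec : EuclideanSpace ℝ (Fin n) → Z → ℝ
  convex_dom : Convex ℝ dom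
  compact_dom : IsCompact dom
  convex_obj : ConvexOn ℝ univ obj
  continuous_obj : Continuous obj
  convex_spec : ∀ z, ConvexOn ℝ univ (fun θ => spec θ z)
  continuous_spec : ∀ z, Continuous (fun θ => spec θ z)
  measurable_spec : ∀ θ, Measurable (spec θ)

namespace ConvexProgram

variable {n : ℕ} {Z : Type*} [MeasurableSpace Z] (P : ConvexProgram n Z) {M : ℕ}

/-- The points that satisfy the constraint `y`. -/
def ok (y : Z) : Set (EuclideanSpace ℝ (Fin n)) := {θ | P.spec θ y ≤ 0}

/-- The points of the domain that satisfy all sampled constraints. -/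
def feas (z : Fin M → Z) : Set (EuclideanSpace ℝ (Fin n)) :=
  {θ | θ ∈ P.dom ∧ ∀ i, θ ∈ P.ok (z i)}

/-- The points of the domain that satisfy all sampled constraints but possibly the `j`-th. -/
def feasOff (z : Fin M → Z) (j : Fin M) : Set (EuclideanSpace ℝ (Fin n)) :=
  {θ | θ ∈ P.dom ∧ ∀ i, i ≠ j → θ ∈ P.ok (z i)}

/-- The infimum of the objective over `A`, which is `⊤` if `A` is empty. -/
noncomputable def val (A : Set (EuclideanSpace ℝ (Fin n))) : EReal :=
  ⨅ θ ∈ A, (P.obj θ : EReal)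

/-- The constraint `y` raises the optimal value of the problem built on `z`. -/
def Raises (z : Fin M → Z) (y : Z) : Prop := P.val (P.feas z) < P.val (P.feas z ∩ P.ok y)

/-- The `j`-th constraint is a support constraint. -/
def Supp (z : Fin M → Z) (j : Fin M) : Prop := P.val (P.feasOff z j) < P.val (P.feas z)

open Classical in
/-- The number of support constraints. -/
noncomputable def numSupp (z : Fin M → Z) : ℕ := (Finset.univ.filter fun j => P.Supp z j).card

/-- The probability that a new constraint leaves the optimal value unchanged. -/
noncomputable def keep (ν : Measure Z) (z : Fin M → Z) : ℝ≥0∞ := ν {y | ¬ P.Raises z y}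

variable {P}

theorem val_anti {A B : Set (EuclideanSpace ℝ (Fin n))} (h : A ⊆ B) : P.val B ≤ P.val A :=
  biInf_mono fun _ hθ => h hθ

theorem val_le {A : Set (EuclideanSpace ℝ (Fin n))} {θ} (h : θ ∈ A) : P.val A ≤ P.obj θ :=
  iInf₂_le θ h

theorem le_val_inter (A : Set (EuclideanSpace ℝ (Fin n))) (y : Z) :
    P.val A ≤ P.val (A ∩ P.ok y) := val_anti inter_subset_left

theorem not_raises_iff {z : Fin M → Z} {y : Z} :
    ¬ P.Raises z y ↔ P.val (P.feas z ∩ P.ok y) = P.val (P.feas z) := by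
  rw [Raises, not_lt]
  exact ⟨fun h => le_antisymm h (le_val_inter _ _), fun h => h.le⟩

theorem exists_of_val_lt {A : Set (EuclideanSpace ℝ (Fin n))} {a : EReal} (h : P.val A < a) :
    ∃ θ ∈ A, (P.obj θ : EReal) < a := by
  simpa [val, iInf_lt_iff] using h

theorem val_empty : P.val ∅ = ⊤ := by simp [val]

theorem nonempty_of_val_lt {A : Set (EuclideanSpace ℝ (Fin n))} {a : EReal} (h : P.val A < a) :
    A.Nonempty := let ⟨θ, hθ, _⟩ := exists_of_val_lt h; ⟨θ, hθ⟩

theorem val_lt_top {A : Set (EuclideanSpace ℝ (Fin n))} (h : A.Nonempty) : P.val A < ⊤ :=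
  let ⟨_, hθ⟩ := h; (val_le hθ).trans_lt (EReal.coe_lt_top _)

theorem exists_val_eq {A : Set (EuclideanSpace ℝ (Fin n))} (hA : IsCompact A)
    (hne : A.Nonempty) : ∃ θ ∈ A, P.val A = P.obj θ := by
  obtain ⟨θ, hθ, hmin⟩ := hA.exists_isMinOn hne P.continuous_obj.continuousOn
  exact ⟨θ, hθ, le_antisymm (val_le hθ)
    (le_iInf₂ fun η hη => EReal.coe_le_coe_iff.2 (hmin hη))⟩

theorem isClosed_ok (y : Z) : IsClosed (P.ok y) :=
  isClosed_le (P.continuous_spec y) continuous_const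

theorem convex_ok (y : Z) : Convex ℝ (P.ok y) := by
  simpa [ok] using (P.convex_spec y).convex_le 0

theorem feas_eq (z : Fin M → Z) : P.feas z = P.dom ∩ ⋂ i, P.ok (z i) := by
  ext; simp [feas]

theorem feasOff_eq (z : Fin M → Z) (j : Fin M) :
    P.feasOff z j = P.dom ∩ ⋂ i, ⋂ (_ : i ≠ j), P.ok (z i) := by
  ext; simp [feasOff]

theorem isCompact_feas (z : Fin M → Z) : IsCompact (P.feas z) := by
  rw [feas_eq]
  exact P.compact_dom.inter_right (isClosed_iInter fun i => isClosed_ok _)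

theorem isCompact_feasOff (z : Fin M → Z) (j : Fin M) : IsCompact (P.feasOff z j) := by
  rw [feasOff_eq]
  exact P.compact_dom.inter_right (isClosed_iInter fun i => isClosed_iInter fun _ => isClosed_ok _)

theorem convex_feas (z : Fin M → Z) : Convex ℝ (P.feas z) := by
  rw [feas_eq]
  exact P.convex_dom.inter (convex_iInter fun i => convex_ok _)

theorem convex_feasOff (z : Fin M → Z) (j : Fin M) : Convex ℝ (P.feasOff z j) := by
  rw [feasOff_eq]
  exact P.convex_dom.inter (convex_iInter fun i => convex_iInter fun _ => convex_ok _)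

theorem feas_subset_feasOff (z : Fin M → Z) (j : Fin M) : P.feas z ⊆ P.feasOff z j :=
  fun _ h => ⟨h.1, fun i _ => h.2 i⟩

theorem feas_insertNth (j : Fin (M + 1)) (y : Z) (w : Fin M → Z) :
    P.feas (j.insertNth y w : Fin (M + 1) → Z) = P.feas w ∩ P.ok y := by
  ext θ
  simp only [feas, mem_ofPred_eq, mem_inter_iff, Fin.forall_iff_succAbove j,
    Fin.insertNth_apply_same, Fin.insertNth_apply_succAbove]
  tauto

theorem feasOff_insertNth_same (j : Fin (M + 1)) (y : Z) (w : Fin M → Z) :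
    P.feasOff (j.insertNth y w : Fin (M + 1) → Z) j = P.feas w := by
  ext θ
  simp [feas, feasOff, Fin.forall_iff_succAbove j, Fin.succAbove_ne]

theorem feasOff_insertNth_succAbove (j : Fin (M + 1)) (k : Fin M) (y : Z) (w : Fin M → Z) :
    P.feasOff (j.insertNth y w : Fin (M + 1) → Z) (j.succAbove k) = P.feasOff w k ∩ P.ok y := by
  ext θ
  simp [feasOff, Fin.forall_iff_succAbove j, Fin.ne_succAbove]
  tauto

theorem supp_insertNth_same (j : Fin (M + 1)) (y : Z) (w : Fin M → Z) :
    P.Supp (j.insertNth y w : Fin (M + 1) → Z) j ↔ P.Raises w y := by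
  rw [Supp, Raises, feasOff_insertNth_same, feas_insertNth]

/-- A feasible problem has at most `n` support constraints. -/
theorem numSupp_le (z : Fin M → Z) (hz : (P.feas z).Nonempty) : P.numSupp z ≤ n := by
  classical
  by_contra! hlt
  set S := Finset.univ.filter fun j => P.Supp z j with hS
  have hcard : n < S.card := by rw [numSupp] at hlt; convert hlt
  -- Helly for the strict sublevel set of the optimal value together with one set per support
  -- constraint, at least `n + 2` sets in all. Without the sublevel set the minimiser is a common
  -- point; without the `j`-th constraint a strictly better point is. A point common to all of them
  -- would be feasible and better than optimal.
  let F : Option (Fin M) → Set (EuclideanSpace ℝ (Fin n)) := fun o =>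
    o.elim {θ | θ ∈ univ ∧ (P.obj θ : EReal) < P.val (P.feas z)}
      (fun j => P.dom ∩ P.ok (z j) ∩ ⋂ i, ⋂ (_ : i ∉ S), P.ok (z i))
  obtain ⟨θ₀, hθ₀, hval⟩ := exists_val_eq (P := P) (isCompact_feas z) hz
  have hconv : ∀ o ∈ (Finset.insertNone S), Convex ℝ (F o) := by
    rintro (_ | j) -
    · simp only [F, Option.elim, hval, EReal.coe_lt_coe_iff]
      exact P.convex_obj.convex_lt _
    · exact (P.convex_dom.inter (convex_ok _)).inter
        (convex_iInter fun i => convex_iInter fun _ => convex_ok _)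
  have hne : (⋂ o ∈ Finset.insertNone S, F o).Nonempty := by
    refine Convex.helly_theorem' hconv fun I hI hIc => ?_
    rw [finrank_euclideanSpace_fin] at hIc
    have hne : I ≠ Finset.insertNone S := by
      rintro rfl
      rw [Finset.card_insertNone] at hIc
      omega
    obtain ⟨o, ho, hoI⟩ := Finset.exists_of_ssubset (hI.ssubset_of_ne hne)
    rcases o with _ | j
    · refine ⟨θ₀, mem_iInter₂.2 ?_⟩
      rintro (_ | i) hi
      · exact absurd hi hoI
      · exact ⟨⟨hθ₀.1, hθ₀.2 i⟩, mem_iInter₂.2 fun k _ => hθ₀.2 k⟩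
    · have hj : P.Supp z j := by simpa [hS] using ho
      obtain ⟨θ, hθ, hlt⟩ := exists_of_val_lt hj
      refine ⟨θ, mem_iInter₂.2 ?_⟩
      rintro (_ | i) hi
      · exact ⟨mem_univ _, hlt⟩
      · refine ⟨⟨hθ.1, hθ.2 i ?_⟩, mem_iInter₂.2 fun k hk => hθ.2 k ?_⟩
        · rintro rfl; exact hoI hi
        · rintro rfl; exact hk (by simpa using ho)
  obtain ⟨θ, hθ⟩ := hne
  rw [mem_iInter₂] at hθ
  have h0 := (hθ none (by simp)).2
  obtain ⟨j, hj⟩ : S.Nonempty := Finset.card_pos.1 (by omega)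
  have hmem : θ ∈ P.feas z := by
    refine ⟨(hθ (some j) (by simpa using hj)).1.1, fun i => ?_⟩
    by_cases hi : i ∈ S
    · exact (hθ (some i) (by simpa using hi)).1.2
    · exact mem_iInter₂.1 (hθ (some j) (by simpa using hj)).2 i hi
  exact absurd h0 (not_lt.2 (val_le hmem))

/-- If removing any single constraint makes a problem with at least `n + 2` constraints feasible,
then the problem is feasible. -/
theorem feas_nonempty_of_feasOff (hM : n + 1 < M) (z : Fin M → Z)
    (h : ∀ j, (P.feasOff z j).Nonempty) : (P.feas z).Nonempty := by
  classical
  have := Convex.helly_theorem' (𝕜 := ℝ) (F := fun i => P.dom ∩ P.ok (z i)) (s := Finset.univ)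
    (fun i _ => P.convex_dom.inter (convex_ok _)) (fun I _ hI => by
      rw [finrank_euclideanSpace_fin] at hI
      obtain ⟨j, hj⟩ : ∃ j, j ∉ I := by
        by_contra! hall
        have : I = Finset.univ := Finset.eq_univ_iff_forall.2 hall
        rw [this, Finset.card_univ, Fintype.card_fin] at hI
        omega
      obtain ⟨θ, hθ⟩ := h j
      exact ⟨θ, mem_iInter₂.2 fun i hi => ⟨hθ.1, hθ.2 i (by rintro rfl; exact hj hi)⟩⟩)
  obtain ⟨θ, hθ⟩ := this
  simp only [Finset.mem_univ, iInter_true, mem_iInter] at hθ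
  exact ⟨θ, (hθ ⟨0, by omega⟩).1, fun i => (hθ i).2⟩

/-- Uniqueness of the minimiser over `A`. -/
def UniqueMin (P : ConvexProgram n Z) (A : Set (EuclideanSpace ℝ (Fin n))) : Prop :=
  ∀ θ ∈ A, ∀ η ∈ A, P.val A = P.obj θ → P.val A = P.obj η → θ = η

/-- A minimiser over the smaller set with the same value also minimises over `A`, so uniqueness
forces it to be `θ`. -/
theorem val_inter_eq_iff {A : Set (EuclideanSpace ℝ (Fin n))} (hA : IsCompact A)
    (hu : P.UniqueMin A) {θ} (hθ : θ ∈ A) (hv : P.val A = P.obj θ) (y : Z) :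
    P.val (A ∩ P.ok y) = P.val A ↔ P.spec θ y ≤ 0 := by
  constructor
  · intro h
    have hne : (A ∩ P.ok y).Nonempty := by
      rw [nonempty_iff_ne_empty]
      intro h0
      rw [h0, val_empty, hv] at h
      exact EReal.coe_ne_top _ h.symm
    obtain ⟨η, hη, hη'⟩ := exists_val_eq (P := P) (hA.inter_right (isClosed_ok y)) hne
    have : η = θ := hu η hη.1 θ hθ (h ▸ hη') hv
    exact this ▸ hη.2
  · intro h
    exact le_antisymm (hv ▸ val_le ⟨hθ, h⟩) (le_val_inter _ _)

/-- Replaces violation at the chosen solution by a condition on optimal values alone, which is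
jointly measurable in the samples and the new constraint. -/
theorem raises_iff_spec_pos {z : Fin M → Z} (hu : P.UniqueMin (P.feas z)) {θ}
    (hθ : θ ∈ P.feas z) (hv : P.val (P.feas z) = P.obj θ) (y : Z) :
    P.Raises z y ↔ 0 < P.spec θ y := by
  rw [← not_iff_not, not_raises_iff, val_inter_eq_iff (isCompact_feas z) hu hθ hv, not_lt]

/-- This half needs no uniqueness of minimisers, so it is available without perturbation. -/
theorem keep_insertNth_le (ν : Measure Z) (j : Fin (M + 1)) {y : Z} {w : Fin M → Z}
    (h : ¬ P.Raises w y) :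
    P.keep ν (j.insertNth y w : Fin (M + 1) → Z) ≤ P.keep ν w := by
  refine measure_mono fun y' hy' => ?_
  simp only [mem_ofPred_eq, not_raises_iff, feas_insertNth] at hy' h ⊢
  refine le_antisymm ?_ (le_val_inter _ _)
  calc P.val (P.feas w ∩ P.ok y') ≤ P.val (P.feas w ∩ P.ok y ∩ P.ok y') :=
        val_anti (by intro θ hθ; exact ⟨hθ.1.1, hθ.2⟩)
    _ = P.val (P.feas w) := by rw [hy', h]

/-- The unique minimiser for `w` satisfies `y` and remains optimal; a later constraint that it
satisfies cannot raise the value. -/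
theorem keep_insertNth (ν : Measure Z) (j : Fin (M + 1)) {y : Z} {w : Fin M → Z}
    (hw : (P.feas w).Nonempty) (hu : P.UniqueMin (P.feas w)) (h : ¬ P.Raises w y) :
    P.keep ν (j.insertNth y w : Fin (M + 1) → Z) = P.keep ν w := by
  refine le_antisymm (keep_insertNth_le ν j h) (measure_mono fun y' hy' => ?_)
  simp only [mem_ofPred_eq] at hy' ⊢
  obtain ⟨θ, hθ, hv⟩ := exists_val_eq (P := P) (isCompact_feas w) hw
  rw [raises_iff_spec_pos hu hθ hv, not_lt] at h hy'
  rw [not_raises_iff, feas_insertNth]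
  refine le_antisymm ?_ (le_val_inter _ _)
  calc P.val (P.feas w ∩ P.ok y ∩ P.ok y') ≤ P.obj θ := val_le ⟨⟨hθ, h⟩, hy'⟩
    _ = P.val (P.feas w) := hv.symm
    _ ≤ _ := le_val_inter _ _

/-- Two constraints, neither of them a support constraint, that are jointly needed to keep the
optimal value: the constraint `y` next to `w`, and the `k`-th constraint of `w`. -/
def Degenerate (P : ConvexProgram n Z) (k : Fin M) (y : Z) (w : Fin M → Z) : Prop :=
  P.val (P.feas w ∩ P.ok y) = P.val (P.feas w) ∧
    P.val (P.feasOff w k ∩ P.ok y) = P.val (P.feas w) ∧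
    P.val (P.feasOff w k) < P.val (P.feas w)

/-- The new constraint is not a support constraint. An old one could lose that status only if `y`
took over its role, which is the degenerate situation; it cannot gain it, because `y` only shrinks
the set left after its removal. -/
theorem numSupp_insertNth (j : Fin (M + 1)) {y : Z} {w : Fin M → Z} (h : ¬ P.Raises w y)
    (hd : ∀ k, ¬ P.Degenerate k y w) :
    P.numSupp (j.insertNth y w : Fin (M + 1) → Z) = P.numSupp w := by
  classical
  have key : ∀ k, P.Supp (j.insertNth y w : Fin (M + 1) → Z) (j.succAbove k) ↔ P.Supp w k := by
    intro k
    rw [Supp, Supp, feasOff_insertNth_succAbove, feas_insertNth, not_raises_iff.1 h]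
    refine ⟨fun hlt => (le_val_inter _ _).trans_lt hlt, fun hlt => ?_⟩
    refine lt_of_le_of_ne ?_ fun he => hd k ⟨not_raises_iff.1 h, he, hlt⟩
    rw [← not_raises_iff.1 h]
    exact val_anti (inter_subset_inter_left _ (feas_subset_feasOff w k))
  have h0 : ¬ P.Supp (j.insertNth y w : Fin (M + 1) → Z) j := by rwa [supp_insertNth_same]
  rw [numSupp, numSupp, Finset.card_filter, Finset.card_filter, Fin.sum_univ_succAbove _ j,
    if_neg h0, zero_add]
  exact Finset.sum_congr rfl fun k _ => by simp only [key]

end ConvexProgram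

/-! ### Measurability of optimal values -/

namespace ConvexProgram

variable {n : ℕ} {Z : Type*} [MeasurableSpace Z] {P : ConvexProgram n Z} {M : ℕ}

/-- The uncountable existential becomes countable by searching a dense subset with slack `1 / (k +
1)`; compactness of the domain and continuity recover an exact solution as the slack vanishes. -/
theorem measurableSet_exists_le {W ι : Type*} [MeasurableSpace W] [Finite ι] (c : ι → W → Z)
    (hc : ∀ i, Measurable (c i)) (r : ℝ) :
    MeasurableSet {w | ∃ θ ∈ P.dom, P.obj θ ≤ r ∧ ∀ i, P.spec θ (c i w) ≤ 0} := by
  obtain ⟨D, hDc, hDd⟩ := TopologicalSpace.exists_countable_dense P.dom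
  have heq : {w | ∃ θ ∈ P.dom, P.obj θ ≤ r ∧ ∀ i, P.spec θ (c i w) ≤ 0} =
      ⋂ k : ℕ, ⋃ θ ∈ D, {w | P.obj θ < r + 1 / ((k : ℝ) + 1) ∧
        ∀ i, P.spec θ (c i w) < 1 / ((k : ℝ) + 1)} := by
    ext w
    simp only [mem_ofPred_eq, mem_iInter, mem_iUnion, exists_prop]
    constructor
    · rintro ⟨θ, hθ, ho, hs⟩ k
      have hk : (0 : ℝ) < 1 / ((k : ℝ) + 1) := by positivity
      have hopen : IsOpen {η : P.dom | P.obj η < r + 1 / ((k : ℝ) + 1) ∧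
          ∀ i, P.spec η (c i w) < 1 / ((k : ℝ) + 1)} := by
        have : {η : P.dom | P.obj η < r + 1 / ((k : ℝ) + 1) ∧
          ∀ i, P.spec η (c i w) < 1 / ((k : ℝ) + 1)} = {η : P.dom | P.obj η < r + 1 / ((k : ℝ) + 1)}
            ∩ ⋂ i, {η : P.dom | P.spec η (c i w) < 1 / ((k : ℝ) + 1)} := by
          ext; simp
        rw [this]
        refine (isOpen_lt (P.continuous_obj.comp continuous_subtype_val) continuous_const).inter
          (isOpen_iInter_of_finite fun i => isOpen_lt
            ((P.continuous_spec _).comp continuous_subtype_val) continuous_const)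
      obtain ⟨η, hη, hηD⟩ := hDd.exists_mem_open hopen
        ⟨⟨θ, hθ⟩, by simp only; linarith, fun i => (hs i).trans_lt hk⟩
      exact ⟨η, hη, hηD⟩
    · intro h
      choose θ hθD ho hs using h
      obtain ⟨a, ha, φ, hφ, hlim⟩ := P.compact_dom.tendsto_subseq (fun k => (θ k).2)
      have h1 : Filter.Tendsto (fun k : ℕ => (1 : ℝ) / ((φ k : ℝ) + 1)) Filter.atTop (nhds 0) :=
        (tendsto_one_div_add_atTop_nhds_zero_nat).comp hφ.tendsto_atTop
      refine ⟨a, ha, ?_, fun i => ?_⟩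
      · refine le_of_tendsto_of_tendsto ((P.continuous_obj.tendsto a).comp hlim)
          (by simpa using h1.const_add r) (Filter.Eventually.of_forall fun k => ?_)
        simpa using (ho (φ k)).le
      · exact le_of_tendsto_of_tendsto (((P.continuous_spec _).tendsto a).comp hlim) h1
          (Filter.Eventually.of_forall fun k => (hs (φ k) i).le)
  rw [heq]
  refine MeasurableSet.iInter fun k => MeasurableSet.biUnion hDc fun θ _ => ?_
  have : {w | P.obj θ < r + 1 / ((k : ℝ) + 1) ∧ ∀ i, P.spec θ (c i w) < 1 / ((k : ℝ) + 1)} =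
      {w | P.obj θ < r + 1 / ((k : ℝ) + 1)} ∩ ⋂ i, {w | P.spec θ (c i w) < 1 / ((k : ℝ) + 1)} := by
    ext; simp
  rw [this]
  refine (MeasurableSet.const _).inter (MeasurableSet.iInter fun i => ?_)
  exact measurableSet_lt ((P.measurable_spec _).comp (hc i)) measurable_const

theorem measurable_val {W ι : Type*} [MeasurableSpace W] [Finite ι] (c : ι → W → Z)
    (hc : ∀ i, Measurable (c i)) :
    Measurable fun w => P.val (P.dom ∩ ⋂ i, P.ok (c i w)) := by
  refine measurable_of_Iio fun a => ?_
  have heq : (fun w => P.val (P.dom ∩ ⋂ i, P.ok (c i w))) ⁻¹' Iio a =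
      ⋃ r : ℚ, ⋃ (_ : ((r : ℝ) : EReal) < a),
        {w | ∃ θ ∈ P.dom, P.obj θ ≤ r ∧ ∀ i, P.spec θ (c i w) ≤ 0} := by
    ext w
    simp only [mem_preimage, mem_Iio, mem_iUnion, mem_ofPred_eq, exists_prop]
    constructor
    · intro h
      obtain ⟨θ, hθ, hlt⟩ := exists_of_val_lt h
      obtain ⟨r, hr1, hr2⟩ := EReal.lt_iff_exists_rat_btwn.1 hlt
      exact ⟨r, hr2, θ, hθ.1, (EReal.coe_lt_coe_iff.1 hr1).le, fun i => mem_iInter.1 hθ.2 i⟩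
    · rintro ⟨r, hr, θ, hθ, ho, hs⟩
      have hmem : θ ∈ P.dom ∩ ⋂ i, P.ok (c i w) := ⟨hθ, mem_iInter.2 hs⟩
      exact (val_le hmem).trans_lt ((EReal.coe_le_coe_iff.2 ho).trans_lt hr)
  rw [heq]
  exact MeasurableSet.iUnion fun r => MeasurableSet.iUnion fun _ => measurableSet_exists_le c hc r

theorem measurable_val_feas : Measurable fun z : Fin M → Z => P.val (P.feas z) := by
  simp only [feas_eq]
  exact measurable_val (P := P) (W := Fin M → Z) (ι := Fin M) (fun i z => z i)
    fun i => measurable_pi_apply i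

theorem measurable_val_feasOff (j : Fin M) :
    Measurable fun z : Fin M → Z => P.val (P.feasOff z j) := by
  have : ∀ z : Fin M → Z, P.feasOff z j = P.dom ∩ ⋂ i : {i // i ≠ j}, P.ok (z i) := by
    intro z; rw [feasOff_eq]; simp [iInter_subtype]
  simp only [this]
  exact measurable_val (P := P) (W := Fin M → Z) (ι := {i // i ≠ j}) (fun i z => z i)
    fun i => measurable_pi_apply _

theorem measurable_insertNth (j : Fin (M + 1)) :
    Measurable fun x : Z × (Fin M → Z) => (j.insertNth x.1 x.2 : Fin (M + 1) → Z) :=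
  (MeasurableEquiv.piFinSuccAbove (fun _ => Z) j).symm.measurable

theorem measurable_val_inter :
    Measurable fun x : Z × (Fin M → Z) => P.val (P.feas x.2 ∩ P.ok x.1) := by
  simp only [← feas_insertNth 0]
  exact measurable_val_feas.comp (measurable_insertNth 0)

theorem measurable_val_feasOff_inter (k : Fin M) :
    Measurable fun x : Z × (Fin M → Z) => P.val (P.feasOff x.2 k ∩ P.ok x.1) := by
  simp only [← feasOff_insertNth_succAbove 0]
  exact (measurable_val_feasOff _).comp (measurable_insertNth 0)

theorem measurableSet_raises :
    MeasurableSet {x : Z × (Fin M → Z) | P.Raises x.2 x.1} :=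
  measurableSet_lt (measurable_val_feas.comp measurable_snd) measurable_val_inter

theorem measurableSet_raises_right (z : Fin M → Z) : MeasurableSet {y | P.Raises z y} :=
  measurable_prodMk_right measurableSet_raises

theorem measurableSet_not_raises (z : Fin M → Z) : MeasurableSet {y | ¬ P.Raises z y} :=
  (measurableSet_raises_right z).compl

theorem measurableSet_supp (j : Fin M) : MeasurableSet {z : Fin M → Z | P.Supp z j} :=
  measurableSet_lt (measurable_val_feasOff j) measurable_val_feas

theorem measurableSet_degenerate (k : Fin M) :
    MeasurableSet {x : Z × (Fin M → Z) | P.Degenerate k x.1 x.2} :=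
  (measurableSet_eq_fun measurable_val_inter (measurable_val_feas.comp measurable_snd)).inter
    ((measurableSet_eq_fun (measurable_val_feasOff_inter k)
      (measurable_val_feas.comp measurable_snd)).inter
      (measurableSet_lt ((measurable_val_feasOff k).comp measurable_snd)
        (measurable_val_feas.comp measurable_snd)))

theorem measurable_numSupp : Measurable fun z : Fin M → Z => P.numSupp z := by
  classical
  simp only [numSupp, Finset.card_filter]
  exact Finset.measurable_sum _ fun j _ =>
    Measurable.ite (measurableSet_supp j) measurable_const measurable_const

theorem measurable_keep (ν : Measure Z) [SFinite ν] :
    Measurable fun z : Fin M → Z => P.keep ν z :=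
  measurable_measure_prodMk_right (μ := ν) measurableSet_raises.compl

theorem keep_le_one (ν : Measure Z) [IsProbabilityMeasure ν] (z : Fin M → Z) :
    P.keep ν z ≤ 1 := prob_le_one

end ConvexProgram

/-! ### Integrating out one sample -/

section InsertNth

variable {Z : Type*} [MeasurableSpace Z] (ν : Measure Z) [IsProbabilityMeasure ν] {M : ℕ}

theorem measurePreserving_insertNth (j : Fin (M + 1)) :
    MeasurePreserving (fun x : Z × (Fin M → Z) => (j.insertNth x.1 x.2 : Fin (M + 1) → Z))
      (ν.prod (Measure.pi fun _ => ν)) (Measure.pi fun _ => ν) :=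
  (measurePreserving_piFinSuccAbove (fun _ => ν) j).symm

theorem lintegral_pi_succ (j : Fin (M + 1)) {φ : (Fin (M + 1) → Z) → ℝ≥0∞} (hφ : Measurable φ) :
    ∫⁻ z, φ z ∂(Measure.pi fun _ => ν) =
      ∫⁻ w, ∫⁻ y, φ (j.insertNth y w) ∂ν ∂(Measure.pi fun _ : Fin M => ν) := by
  have h := (measurePreserving_insertNth ν j).lintegral_comp hφ
  exact h.symm.trans (lintegral_prod_symm (fun x : Z × (Fin M → Z) => φ (j.insertNth x.1 x.2))
    (hφ.comp (measurePreserving_insertNth ν j).measurable).aemeasurable)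

theorem ae_pi_succ (j : Fin (M + 1)) {p : (Fin (M + 1) → Z) → Prop}
    (h : ∀ᵐ z ∂(Measure.pi fun _ => ν), p z) :
    ∀ᵐ w ∂(Measure.pi fun _ : Fin M => ν), ∀ᵐ y ∂ν, p (j.insertNth y w) :=
  Measure.ae_ae_of_ae_prod (Measure.measurePreserving_swap.quasiMeasurePreserving.ae
    ((measurePreserving_insertNth ν j).quasiMeasurePreserving.ae h))

theorem ae_of_ae_pi_removeNth (j : Fin (M + 1)) {p : (Fin M → Z) → Prop}
    (h : ∀ᵐ w ∂(Measure.pi fun _ => ν), p w) :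
    ∀ᵐ z ∂(Measure.pi fun _ : Fin (M + 1) => ν), p (j.removeNth z) :=
  (Measure.quasiMeasurePreserving_snd.comp
    (measurePreserving_piFinSuccAbove (fun _ => ν) j).quasiMeasurePreserving).ae h

end InsertNth

/-! ### Feasibility for all sample sizes, and the moment recursion -/

namespace ConvexProgram

variable {n : ℕ} {Z : Type*} [MeasurableSpace Z] {P : ConvexProgram n Z} {M : ℕ}

theorem feasOff_eq_feas_removeNth (z : Fin (M + 1) → Z) (j : Fin (M + 1)) :
    P.feasOff z j = P.feas (j.removeNth z) := by
  conv_lhs => rw [← Fin.insertNth_self_removeNth j z]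
  rw [feasOff_insertNth_same]

section Feasible

variable {ν : Measure Z} [IsProbabilityMeasure ν]

theorem ae_feas_succ (hM : n + 1 ≤ M)
    (h : ∀ᵐ z ∂(Measure.pi fun _ : Fin M => ν), (P.feas z).Nonempty) :
    ∀ᵐ z ∂(Measure.pi fun _ : Fin (M + 1) => ν), (P.feas z).Nonempty := by
  have h' : ∀ᵐ z ∂(Measure.pi fun _ : Fin (M + 1) => ν), ∀ j : Fin (M + 1),
      (P.feas (j.removeNth z)).Nonempty :=
    ae_all_iff.2 fun j => ae_of_ae_pi_removeNth ν j h
  filter_upwards [h'] with z hz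
  exact feas_nonempty_of_feasOff (by omega) z fun j => by
    rw [feasOff_eq_feas_removeNth]; exact hz j

theorem ae_feas_of_succ
    (h : ∀ᵐ z ∂(Measure.pi fun _ : Fin (M + 1) => ν), (P.feas z).Nonempty) :
    ∀ᵐ z ∂(Measure.pi fun _ : Fin M => ν), (P.feas z).Nonempty := by
  filter_upwards [ae_pi_succ ν 0 h] with w hw
  obtain ⟨y, hy⟩ := hw.exists
  rw [feas_insertNth] at hy
  exact hy.mono inter_subset_left

/-- Fewer constraints are harmless; more constraints are handled by Helly, which works upwards only
from `n + 1` samples. -/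
theorem ae_feas_of_le (hM : n + 1 ≤ M)
    (h : ∀ᵐ z ∂(Measure.pi fun _ : Fin M => ν), (P.feas z).Nonempty) (M' : ℕ) :
    ∀ᵐ z ∂(Measure.pi fun _ : Fin M' => ν), (P.feas z).Nonempty := by
  rcases le_total M M' with hle | hle
  · induction M', hle using Nat.le_induction with
    | base => exact h
    | succ m hm ih => exact ae_feas_succ (by omega) ih
  · exact Nat.decreasingInduction' (fun k _ _ ih => ae_feas_of_succ ih) hle h

end Feasible

section Recursion

variable {ν : Measure Z} [IsProbabilityMeasure ν]

theorem natCast_sub_numSupp (z : Fin M → Z) [∀ j, Decidable (P.Supp z j)] :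
    ((M - P.numSupp z : ℕ) : ℝ≥0∞) = ∑ j, if P.Supp z j then 0 else 1 := by
  classical
  have h := Finset.card_filter_add_card_filter_not (s := (Finset.univ : Finset (Fin M)))
    (fun j => P.Supp z j)
  rw [Finset.card_univ, Fintype.card_fin] at h
  have h' : M - P.numSupp z = (Finset.univ.filter fun j => ¬ P.Supp z j).card := by
    have : P.numSupp z = (Finset.univ.filter fun j => P.Supp z j).card := by
      rw [numSupp]; congr
    omega
  rw [h', Finset.card_filter, Nat.cast_sum]
  refine Finset.sum_congr rfl fun j _ => ?_
  by_cases hj : P.Supp z j <;> simp [hj]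

/-- Summing over the position of a constraint that is not a support constraint. -/
theorem lintegral_mul_sub_numSupp {φ : (Fin (M + 1) → Z) → ℝ≥0∞} (hφ : Measurable φ) :
    ∫⁻ z, φ z * ((M + 1 - P.numSupp z : ℕ) : ℝ≥0∞) ∂(Measure.pi fun _ => ν) =
      ∑ j : Fin (M + 1), ∫⁻ w, ∫⁻ y in {y | ¬ P.Raises w y}, φ (j.insertNth y w) ∂ν
        ∂(Measure.pi fun _ : Fin M => ν) := by
  classical
  have hm : ∀ j : Fin (M + 1), Measurable fun z => φ z * if P.Supp z j then 0 else 1 := fun j =>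
    hφ.mul (Measurable.ite (measurableSet_supp j) measurable_const measurable_const)
  simp only [natCast_sub_numSupp, Finset.mul_sum]
  rw [lintegral_finsetSum _ fun j _ => hm j]
  refine Finset.sum_congr rfl fun j _ => ?_
  rw [lintegral_pi_succ ν j (hm j)]
  refine lintegral_congr fun w => ?_
  rw [← lintegral_indicator (measurableSet_not_raises w)]
  refine lintegral_congr fun y => ?_
  by_cases h : P.Raises w y <;> simp [indicator, supp_insertNth_same, h]

theorem lintegral_mul_keep_le {φ : (Fin (M + 1) → Z) → ℝ≥0∞} (hφ : Measurable φ)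
    {ψ : (Fin M → Z) → ℝ≥0∞}
    (h : ∀ j : Fin (M + 1), ∀ w y, ¬ P.Raises w y → ψ w ≤ φ (j.insertNth y w)) :
    ((M + 1 : ℕ) : ℝ≥0∞) * ∫⁻ w, ψ w * P.keep ν w ∂(Measure.pi fun _ => ν) ≤
      ∫⁻ z, φ z * ((M + 1 - P.numSupp z : ℕ) : ℝ≥0∞) ∂(Measure.pi fun _ => ν) := by
  rw [lintegral_mul_sub_numSupp hφ]
  calc _ = ∑ j : Fin (M + 1), ∫⁻ w, ψ w * P.keep ν w ∂(Measure.pi fun _ => ν) := by simp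
    _ ≤ _ := by
      refine Finset.sum_le_sum fun j _ => lintegral_mono fun w => ?_
      rw [keep, ← setLIntegral_const]
      exact setLIntegral_mono' (measurableSet_not_raises w) fun y hy => h j w y hy

/-- Each of the `M + 1` positions contributes the same integral, because `φ` after insertion of a
harmless constraint no longer depends on that constraint or its position. -/
theorem lintegral_mul_keep {φ : (Fin (M + 1) → Z) → ℝ≥0∞} (hφ : Measurable φ)
    {ψ : (Fin M → Z) → ℝ≥0∞}
    (h : ∀ j : Fin (M + 1), ∀ᵐ w ∂(Measure.pi fun _ => ν), ∀ᵐ y ∂ν,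
      ¬ P.Raises w y → φ (j.insertNth y w) = ψ w) :
    ((M + 1 : ℕ) : ℝ≥0∞) * ∫⁻ w, ψ w * P.keep ν w ∂(Measure.pi fun _ => ν) =
      ∫⁻ z, φ z * ((M + 1 - P.numSupp z : ℕ) : ℝ≥0∞) ∂(Measure.pi fun _ => ν) := by
  rw [lintegral_mul_sub_numSupp hφ]
  calc _ = ∑ j : Fin (M + 1), ∫⁻ w, ψ w * P.keep ν w ∂(Measure.pi fun _ => ν) := by simp
    _ = _ := by
      refine Finset.sum_congr rfl fun j _ => lintegral_congr_ae ?_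
      filter_upwards [h j] with w hw
      rw [keep, ← setLIntegral_const]
      exact (setLIntegral_congr_fun_ae (measurableSet_not_raises w) hw).symm

end Recursion

/-- `∏_{j < m} (M + j + 1 - n) / (M + j + 1 - k)`, the `m`-th moment of the beta distribution with
parameters `M + 1 - n` and `n - k`. -/
noncomputable def moment (n m M k : ℕ) : ℝ≥0∞ :=
  ∏ j ∈ Finset.range m, ((M + j + 1 - n : ℕ) : ℝ≥0∞) / ((M + j + 1 - k : ℕ) : ℝ≥0∞)

theorem moment_succ_mul (n m : ℕ) {M k : ℕ} (hk : k ≤ M) :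
    moment n (m + 1) M k * ((M + 1 - k : ℕ) : ℝ≥0∞) =
      ((M + 1 - n : ℕ) : ℝ≥0∞) * moment n m (M + 1) k := by
  have h : ∀ j, M + (j + 1) + 1 = M + 1 + j + 1 := fun j => by omega
  rw [moment, moment, Finset.prod_range_succ', mul_assoc, add_zero,
    ENNReal.div_mul_cancel (Nat.cast_ne_zero.2 (by omega)) (by simp), mul_comm]
  simp only [h]

/-- The assumptions under which the number of support constraints is stable. -/
structure Nondegenerate (P : ConvexProgram n Z) (ν : Measure Z) [IsProbabilityMeasure ν] :
    Prop where
  feasible : ∀ M, ∀ᵐ z ∂(Measure.pi fun _ : Fin M => ν), (P.feas z).Nonempty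
  unique : ∀ M (z : Fin M → Z), P.UniqueMin (P.feas z)
  nondegenerate : ∀ M (k : Fin M), ∀ᵐ w ∂(Measure.pi fun _ => ν), ∀ᵐ y ∂ν, ¬ P.Degenerate k y w

/-- Induction on `m` with `M` free: the recursion trades one power of `keep` for one more sample.
The weight is chosen so that its product with `M + 1 - numSupp` is, up to a constant, the weight for
`m` and `M + 1`. -/
theorem lintegral_keep_pow_mul_moment {ν : Measure Z} [IsProbabilityMeasure ν]
    (h : P.Nondegenerate ν) (m : ℕ) (hM : n ≤ M) :
    ∫⁻ z, P.keep ν z ^ m * moment n m M (P.numSupp z) ∂(Measure.pi fun _ : Fin M => ν) =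
      moment n m M 0 := by
  induction m generalizing M with
  | zero => simp [moment]
  | succ m ih =>
    have hmeas : ∀ M', Measurable fun z : Fin M' → Z =>
        P.keep ν z ^ m * moment n (m + 1) M (P.numSupp z) := fun M' =>
      ((measurable_keep ν).pow_const m).mul ((Measurable.of_discrete (f := moment n (m + 1) M)).comp measurable_numSupp)
    have key := lintegral_mul_keep (P := P) (ν := ν) (hmeas (M + 1))
      (ψ := fun w => P.keep ν w ^ m * moment n (m + 1) M (P.numSupp w)) (fun j => by
        filter_upwards [h.feasible M, ae_all_iff.2 (h.nondegenerate M)] with w hw hd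
        filter_upwards [ae_all_iff.2 hd] with y hy hr
        rw [keep_insertNth ν j hw (h.unique M w) hr, numSupp_insertNth j hr hy])
    have hR : ∫⁻ z, P.keep ν z ^ m * moment n (m + 1) M (P.numSupp z) *
        ((M + 1 - P.numSupp z : ℕ) : ℝ≥0∞) ∂(Measure.pi fun _ : Fin (M + 1) => ν) =
        ((M + 1 - n : ℕ) : ℝ≥0∞) * moment n m (M + 1) 0 := by
      rw [← ih (M := M + 1) (by omega), ← lintegral_const_mul' _ _ (by simp)]
      refine lintegral_congr_ae ?_
      filter_upwards [h.feasible (M + 1)] with z hz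
      rw [mul_assoc, moment_succ_mul n m ((numSupp_le z hz).trans hM)]
      ring
    rw [hR, ← moment_succ_mul n m (Nat.zero_le M), mul_comm, Nat.sub_zero] at key
    have := (ENNReal.mul_left_inj (c := ((M + 1 : ℕ) : ℝ≥0∞)) (by simp) (by simp)).1 key
    rw [← this]
    refine lintegral_congr fun z => ?_
    rw [pow_succ]; ring

end ConvexProgram

/-! ### Beta functions and beta distributions -/

section BetaFunction

theorem beta_add_one_left {a b : ℝ} (ha : 0 < a) (hb : 0 < b) :
    beta (a + 1) b = a / (a + b) * beta a b := by
  have h1 : a + 1 + b = a + b + 1 := by ring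
  have h2 := Real.Gamma_pos_of_pos (add_pos ha hb)
  have h3 : a + b ≠ 0 := by positivity
  rw [beta, beta, h1, Real.Gamma_add_one ha.ne', Real.Gamma_add_one h3]
  field_simp

theorem beta_symm (a b : ℝ) : beta a b = beta b a := by
  rw [beta, beta, mul_comm, add_comm]

theorem beta_add_natCast_div {a b : ℝ} (ha : 0 < a) (hb : 0 < b) (m : ℕ) :
    beta (a + m) b / beta a b = ∏ j ∈ Finset.range m, (a + j) / (a + j + b) := by
  induction m with
  | zero => simp [(beta_pos ha hb).ne']
  | succ m ih =>
    rw [Finset.prod_range_succ, ← ih, Nat.cast_succ, ← add_assoc,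
      beta_add_one_left (by positivity) hb]
    ring

theorem beta_natCast (k m : ℕ) (hk : k < m) :
    (m : ℝ) * ((m - 1).choose k : ℝ) = 1 / beta (k + 1) (m - k) := by
  have h1 : (m : ℝ) - k = ((m - 1 - k : ℕ) : ℝ) + 1 := by
    rw [Nat.cast_sub (by omega), Nat.cast_sub (by omega)]; push_cast; ring
  have h2 : (k : ℝ) + 1 + (((m - 1 - k : ℕ) : ℝ) + 1) = (m : ℝ) + 1 := by rw [← h1]; ring
  rw [beta, h1, h2, Real.Gamma_nat_eq_factorial, Real.Gamma_nat_eq_factorial,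
    Real.Gamma_nat_eq_factorial]
  have h3 : (m.factorial : ℝ) = m * (m - 1).factorial := by
    rw [← Nat.mul_factorial_pred (by omega : m ≠ 0)]; push_cast; ring
  have h4 : ((m - 1).factorial : ℝ) =
      (m - 1).choose k * k.factorial * (m - 1 - k).factorial := by
    rw [← Nat.choose_mul_factorial_mul_factorial (by omega : k ≤ m - 1)]; push_cast; ring
  rw [h3, h4]
  field_simp

end BetaFunction

section BetaMeasure

theorem betaPDFReal_nonneg {a b : ℝ} (ha : 0 < a) (hb : 0 < b) (x : ℝ) :
    0 ≤ betaPDFReal a b x := by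
  by_cases h : 0 < x ∧ x < 1
  · exact (betaPDFReal_pos h.1 h.2 ha hb).le
  · rw [betaPDFReal, if_neg h]

theorem pow_mul_betaPDFReal {a b : ℝ} (ha : 0 < a) (hb : 0 < b) (i j : ℕ) (x : ℝ) :
    x ^ i * (1 - x) ^ j * betaPDFReal a b x =
      beta (a + i) (b + j) / beta a b * betaPDFReal (a + i) (b + j) x := by
  by_cases h : 0 < x ∧ x < 1
  · have h' : 0 < 1 - x := by linarith [h.2]
    have h1 := beta_pos ha hb
    have h2 : 0 < beta (a + i) (b + j) := beta_pos (by positivity) (by positivity)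
    rw [betaPDFReal, betaPDFReal, if_pos h, if_pos h,
      show a + i - 1 = (a - 1) + i by ring, show b + j - 1 = (b - 1) + j by ring,
      Real.rpow_add_natCast h.1.ne', Real.rpow_add_natCast h'.ne']
    field_simp
  · simp [betaPDFReal, if_neg h]

theorem betaPDFReal_one_sub (a b x : ℝ) : betaPDFReal a b (1 - x) = betaPDFReal b a x := by
  rw [betaPDFReal, betaPDFReal, beta_symm a b, sub_sub_cancel]
  have : (0 < 1 - x ∧ 1 - x < 1) ↔ (0 < x ∧ x < 1) := by constructor <;> rintro ⟨h1, h2⟩ <;>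
    constructor <;> linarith
  simp only [this, mul_right_comm]

theorem measurable_betaPDF (a b : ℝ) : Measurable (betaPDF a b) :=
  (measurable_betaPDFReal a b).ennreal_ofReal

theorem betaMeasure_apply (a b : ℝ) {s : Set ℝ} (hs : MeasurableSet s) :
    betaMeasure a b s = ∫⁻ x in s, betaPDF a b x := withDensity_apply _ hs

theorem betaMeasure_absolutelyContinuous (a b : ℝ) : betaMeasure a b ≪ volume :=
  withDensity_absolutelyContinuous _ _

theorem ae_betaMeasure_mem (a b : ℝ) : ∀ᵐ x ∂(betaMeasure a b), x ∈ Ioo (0 : ℝ) 1 := by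
  rw [betaMeasure, ae_withDensity_iff (measurable_betaPDF a b)]
  refine Filter.Eventually.of_forall fun x hx => ?_
  by_contra h
  exact hx (by simp only [mem_Ioo] at h; rw [betaPDF, betaPDFReal, if_neg h]; simp)

/-- Multiplying a beta density by `x ^ i * (1 - x) ^ j` shifts its parameters. -/
theorem setLIntegral_pow_betaMeasure {a b : ℝ} (ha : 0 < a) (hb : 0 < b) (i j : ℕ) {s : Set ℝ}
    (hs : MeasurableSet s) :
    ∫⁻ x in s, ENNReal.ofReal (x ^ i * (1 - x) ^ j) ∂(betaMeasure a b) =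
      ENNReal.ofReal (beta (a + i) (b + j) / beta a b) * betaMeasure (a + i) (b + j) s := by
  have hc : 0 ≤ beta (a + i) (b + j) / beta a b :=
    (div_pos (beta_pos (by positivity) (by positivity)) (beta_pos ha hb)).le
  rw [betaMeasure, restrict_withDensity hs,
    lintegral_withDensity_eq_lintegral_mul _ (measurable_betaPDF a b) (by fun_prop),
    betaMeasure_apply _ _ hs, ← lintegral_const_mul _ (measurable_betaPDF _ _)]
  refine lintegral_congr fun x => ?_
  rw [Pi.mul_apply, betaPDF, betaPDF, ← ENNReal.ofReal_mul (betaPDFReal_nonneg ha hb x),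
    ← ENNReal.ofReal_mul hc, ← pow_mul_betaPDFReal ha hb, mul_comm]

theorem lintegral_pow_betaMeasure {a b : ℝ} (ha : 0 < a) (hb : 0 < b) (m : ℕ) :
    ∫⁻ x, ENNReal.ofReal (x ^ m) ∂(betaMeasure a b) =
      ∏ j ∈ Finset.range m, ENNReal.ofReal ((a + j) / (a + j + b)) := by
  have := isProbabilityMeasureBeta (α := a + m) (β := b) (by positivity) hb
  have h := setLIntegral_pow_betaMeasure ha hb m 0 MeasurableSet.univ
  simp only [pow_zero, mul_one, Measure.restrict_univ, Nat.cast_zero, add_zero, measure_univ] at h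
  rw [h, beta_add_natCast_div ha hb, ENNReal.ofReal_prod_of_nonneg fun j _ => by positivity]

theorem betaMeasure_Iio_eq_Iic (a b t : ℝ) : betaMeasure a b (Iio t) = betaMeasure a b (Iic t) :=
  measure_congr ((betaMeasure_absolutelyContinuous a b).ae_le Iio_ae_eq_Iic)

theorem Fbeta_eq_measure {a b t : ℝ} (ha : 0 < a) (hb : 0 < b) (ht : 0 ≤ t) :
    Fbeta a b t = (betaMeasure a b).real (Iio t) := by
  rw [Fbeta, intervalIntegral.integral_of_le ht, Measure.real, betaMeasure_Iio_eq_Iic,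
    betaMeasure_apply _ _ measurableSet_Iic,
    integral_eq_lintegral_of_nonneg_ae
      (Filter.Eventually.of_forall fun x => betaPDFReal_nonneg ha hb x)
      (measurable_betaPDFReal a b).aestronglyMeasurable]
  congr 1
  change ∫⁻ x in Ioc 0 t, betaPDF a b x = _
  rw [← Iic_union_Ioc_eq_Iic ht, lintegral_union measurableSet_Ioc (Iic_disjoint_Ioc le_rfl),
    setLIntegral_eq_zero measurableSet_Iic fun x hx => betaPDF_eq_zero_of_nonpos hx, zero_add]

/-- Beta distributions are stochastically monotone in their parameters. -/
theorem betaMeasure_Iio_le {a a' b b' t : ℝ} (ha' : 0 < a') (haa' : a' ≤ a) (hb : 0 < b)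
    (hbb' : b ≤ b') (ht0 : 0 < t) (ht1 : t < 1) :
    (betaMeasure a b).real (Iio t) ≤ (betaMeasure a' b').real (Iio t) := by
  have ha := ha'.trans_le haa'
  have hb' := hb.trans_le hbb'
  have := isProbabilityMeasureBeta ha hb
  have := isProbabilityMeasureBeta ha' hb'
  -- The ratio of the two densities is increasing on the unit interval, and `c` is its value at `t`.
  -- So `c` bounds the ratio from above on the left of `t` and from below on the right.
  set c := beta a' b' / beta a b * t ^ (a - a') * (1 - t) ^ (b - b') with hc
  have hc0 : 0 ≤ c := by
    have := beta_pos ha hb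
    have := beta_pos ha' hb'
    have : 0 < 1 - t := by linarith
    positivity
  have hpdf : ∀ x, 0 < x → x < 1 → betaPDFReal a b x =
      beta a' b' / beta a b * x ^ (a - a') * (1 - x) ^ (b - b') * betaPDFReal a' b' x := by
    intro x h0 h1
    have h1' : 0 < 1 - x := by linarith
    have e1 := (beta_pos ha hb).ne'
    have e2 := (beta_pos ha' hb').ne'
    rw [betaPDFReal, betaPDFReal, if_pos ⟨h0, h1⟩, if_pos ⟨h0, h1⟩,
      show a - 1 = (a - a') + (a' - 1) by ring, show b - 1 = (b - b') + (b' - 1) by ring,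
      Real.rpow_add h0, Real.rpow_add h1']
    field_simp
  have hratio : ∀ x y, 0 < x → x ≤ y → y < 1 →
      beta a' b' / beta a b * x ^ (a - a') * (1 - x) ^ (b - b') ≤
      beta a' b' / beta a b * y ^ (a - a') * (1 - y) ^ (b - b') := by
    intro x y h0 hxy h1
    have h2 : 0 < 1 - y := by linarith
    have e : 0 ≤ beta a' b' / beta a b := (div_pos (beta_pos ha' hb') (beta_pos ha hb)).le
    have h3 : x ^ (a - a') ≤ y ^ (a - a') := Real.rpow_le_rpow h0.le hxy (by linarith)
    have h4 : (1 - x) ^ (b - b') ≤ (1 - y) ^ (b - b') :=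
      Real.rpow_le_rpow_of_nonpos h2 (by linarith) (by linarith)
    have h5 : 0 ≤ (1 - x) ^ (b - b') := Real.rpow_nonneg (by linarith) _
    have h6 : 0 ≤ y ^ (a - a') := Real.rpow_nonneg (by linarith) _
    exact mul_le_mul (mul_le_mul_of_nonneg_left h3 e) h4 h5 (mul_nonneg e h6)
  have hle : betaMeasure a b (Iio t) ≤ ENNReal.ofReal c * betaMeasure a' b' (Iio t) := by
    rw [betaMeasure_apply _ _ measurableSet_Iio, betaMeasure_apply _ _ measurableSet_Iio,
      ← lintegral_const_mul _ (measurable_betaPDF _ _)]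
    refine setLIntegral_mono' measurableSet_Iio fun x hx => ?_
    rcases le_or_gt x 0 with h0 | h0
    · rw [betaPDF_eq_zero_of_nonpos h0]; exact zero_le
    · have hx : x < t := hx
      rw [betaPDF, betaPDF, ← ENNReal.ofReal_mul hc0, hpdf x h0 (hx.trans ht1)]
      exact ENNReal.ofReal_le_ofReal (mul_le_mul_of_nonneg_right (hratio x t h0 hx.le ht1)
        (betaPDFReal_nonneg ha' hb' x))
  have hge : ENNReal.ofReal c * betaMeasure a' b' (Ici t) ≤ betaMeasure a b (Ici t) := by
    rw [betaMeasure_apply _ _ measurableSet_Ici, betaMeasure_apply _ _ measurableSet_Ici,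
      ← lintegral_const_mul _ (measurable_betaPDF _ _)]
    refine setLIntegral_mono' measurableSet_Ici fun x hx => ?_
    rcases le_or_gt 1 x with h1 | h1
    · rw [betaPDF_eq_zero_of_one_le h1, mul_zero]; exact zero_le
    · have hx : t ≤ x := hx
      rw [betaPDF, betaPDF, ← ENNReal.ofReal_mul hc0, hpdf x (ht0.trans_le hx) h1]
      exact ENNReal.ofReal_le_ofReal (mul_le_mul_of_nonneg_right (hratio t x ht0 hx h1)
        (betaPDFReal_nonneg ha' hb' x))
  have e1 : (betaMeasure a b).real (Ici t) = 1 - (betaMeasure a b).real (Iio t) := by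
    rw [← compl_Iio, probReal_compl_eq_one_sub measurableSet_Iio]
  have e2 : (betaMeasure a' b').real (Ici t) = 1 - (betaMeasure a' b').real (Iio t) := by
    rw [← compl_Iio, probReal_compl_eq_one_sub measurableSet_Iio]
  have hle' := ENNReal.toReal_mono (by finiteness) hle
  have hge' := ENNReal.toReal_mono (by finiteness) hge
  rw [ENNReal.toReal_mul, ENNReal.toReal_ofReal hc0] at hle' hge'
  change (betaMeasure a b).real (Iio t) ≤ c * (betaMeasure a' b').real (Iio t) at hle'
  change c * (betaMeasure a' b').real (Ici t) ≤ (betaMeasure a b).real (Ici t) at hge'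
  rw [e1, e2] at hge'
  have hp1 : (betaMeasure a b).real (Iio t) ≤ 1 := measureReal_le_one
  have hp2 : (betaMeasure a' b').real (Iio t) ≤ 1 := measureReal_le_one
  have hp3 : 0 ≤ (betaMeasure a' b').real (Iio t) := measureReal_nonneg
  -- If the claim failed, the bound on the left of `t` would force `c > 1`, and the bound on the
  -- right would then fail.
  by_contra! hlt
  nlinarith

theorem Fbeta_le_Fbeta {a a' b b' t : ℝ} (ha' : 0 < a') (haa' : a' ≤ a) (hb : 0 < b)
    (hbb' : b ≤ b') (ht0 : 0 ≤ t) (ht1 : t ≤ 1) : Fbeta a b t ≤ Fbeta a' b' t := by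
  have ha := ha'.trans_le haa'
  have hb' := hb.trans_le hbb'
  rcases ht0.eq_or_lt with rfl | ht0'
  · simp [Fbeta]
  rw [Fbeta_eq_measure ha hb ht0, Fbeta_eq_measure ha' hb' ht0]
  rcases ht1.eq_or_lt with rfl | ht1'
  · have := isProbabilityMeasureBeta ha hb
    have := isProbabilityMeasureBeta ha' hb'
    have h : ∀ a b : ℝ, 0 < a → 0 < b → (betaMeasure a b).real (Iio 1) = 1 := by
      intro a b ha hb
      have := isProbabilityMeasureBeta ha hb
      have h : betaMeasure a b (Iio 1) = 1 :=
        (prob_compl_eq_zero_iff measurableSet_Iio).1 (by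
          rw [← mem_ae_iff]
          exact (ae_betaMeasure_mem a b).mono fun x hx => hx.2)
      rw [Measure.real, h, ENNReal.toReal_one]
    rw [h a b ha hb, h a' b' ha' hb']
  · exact betaMeasure_Iio_le ha' haa' hb hbb' ht0' ht1'

/-- The distribution function of the binomial distribution, as a function of the success
probability. -/
noncomputable def binomialCDF (m k : ℕ) (v : ℝ) : ℝ :=
  ∑ i ∈ Finset.range (k + 1), (m.choose i : ℝ) * v ^ i * (1 - v) ^ (m - i)

/-- The derivative of the partial sum of Bernstein polynomials telescopes to a single one, which is
minus a beta density. Integrate from `v` to `1`, where the sum vanishes because `k < m`. -/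
theorem binomialCDF_eq_Fbeta {m k : ℕ} (hk : k < m) {v : ℝ} (hv0 : 0 ≤ v) (hv1 : v ≤ 1) :
    binomialCDF m k v = Fbeta (m - k) (k + 1) (1 - v) := by
  let p : Polynomial ℝ := ∑ i ∈ Finset.range (k + 1), bernsteinPolynomial ℝ m i
  have hp : ∀ x, p.eval x = binomialCDF m k x := by
    intro x; simp [p, binomialCDF, bernsteinPolynomial, Polynomial.eval_finsetSum]
  have hd : p.derivative = -(m * bernsteinPolynomial ℝ (m - 1) k) := by
    have : ∀ l, (∑ i ∈ Finset.range (l + 1), bernsteinPolynomial ℝ m i).derivative =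
        -(m * bernsteinPolynomial ℝ (m - 1) l) := by
      intro l
      induction l with
      | zero => simp [bernsteinPolynomial.derivative_zero]
      | succ l ih =>
        rw [Finset.sum_range_succ, Polynomial.derivative_add, ih,
          bernsteinPolynomial.derivative_succ]
        ring
    exact this k
  have h1 : p.eval 1 = 0 := by
    rw [hp, binomialCDF]
    refine Finset.sum_eq_zero fun i hi => ?_
    rw [Finset.mem_range] at hi
    rw [sub_self, zero_pow (by omega), mul_zero]
  have hint : ∫ x in v..1, p.derivative.eval x = p.eval 1 - p.eval v :=
    intervalIntegral.integral_eq_sub_of_hasDerivAt (fun x _ => p.hasDerivAt x)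
      (p.derivative.continuous.intervalIntegrable _ _)
  have hF : Fbeta (m - k) (k + 1) (1 - v) = ∫ x in v..1, betaPDFReal (k + 1) (m - k) x := by
    have h := intervalIntegral.integral_comp_sub_left (a := 0) (b := 1 - v)
      (fun x => betaPDFReal (k + 1) (m - k) x) 1
    simpa only [Fbeta, betaPDFReal_one_sub, sub_sub_cancel, sub_zero] using h
  have hint2 : ∫ x in v..1, betaPDFReal (k + 1) (m - k) x = ∫ x in v..1, -p.derivative.eval x := by
    -- The density is set to zero at the endpoints, where the polynomial need not vanish; hence the
    -- passage to the open interval.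
    rw [intervalIntegral.integral_of_le hv1, intervalIntegral.integral_of_le hv1,
      integral_Ioc_eq_integral_Ioo, integral_Ioc_eq_integral_Ioo]
    refine setIntegral_congr_fun measurableSet_Ioo fun x hx => ?_
    have hx1 : 0 < 1 - x := by linarith [hx.2]
    simp only [betaPDFReal]
    rw [if_pos ⟨hv0.trans_lt hx.1, hx.2⟩, ← beta_natCast k m hk, hd]
    simp only [bernsteinPolynomial, Polynomial.eval_neg, Polynomial.eval_mul,
      Polynomial.eval_natCast, Polynomial.eval_pow, Polynomial.eval_X, Polynomial.eval_sub,
      Polynomial.eval_one, neg_neg, add_sub_cancel_right, Real.rpow_natCast]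
    rw [show (m : ℝ) - k - 1 = ((m - 1 - k : ℕ) : ℝ) by
      rw [Nat.cast_sub (by omega), Nat.cast_sub (by omega)]; push_cast; ring, Real.rpow_natCast]
    ring
  rw [hF, hint2, intervalIntegral.integral_neg, hint, h1, hp]
  ring

end BetaMeasure

/-! ### Determination of a measure by its moments -/

/-- Finite measures on the unit interval are determined by their moments. -/
theorem Measure.ext_of_moments_Icc {μ₁ μ₂ : Measure ℝ} [IsFiniteMeasure μ₁] [IsFiniteMeasure μ₂]
    (h₁ : ∀ᵐ x ∂μ₁, x ∈ Icc (0 : ℝ) 1) (h₂ : ∀ᵐ x ∂μ₂, x ∈ Icc (0 : ℝ) 1)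
    (h : ∀ m : ℕ, ∫⁻ x, ENNReal.ofReal (x ^ m) ∂μ₁ = ∫⁻ x, ENNReal.ofReal (x ^ m) ∂μ₂) :
    μ₁ = μ₂ := by
  have hint : ∀ (μ : Measure ℝ) [IsFiniteMeasure μ], (∀ᵐ x ∂μ, x ∈ Icc (0 : ℝ) 1) →
      ∀ f : ℝ → ℝ, Continuous f → Integrable f μ := by
    intro μ _ hμ f hf
    obtain ⟨C, hC⟩ := isCompact_Icc.exists_bound_of_continuousOn
      (hf.continuousOn (s := Icc (0 : ℝ) 1))
    exact Integrable.of_bound hf.aestronglyMeasurable C (hμ.mono hC)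
  have hpow : ∀ m : ℕ, ∫ x, x ^ m ∂μ₁ = ∫ x, x ^ m ∂μ₂ := by
    intro m
    rw [integral_eq_lintegral_of_nonneg_ae (h₁.mono fun x hx => pow_nonneg hx.1 m)
        (by fun_prop),
      integral_eq_lintegral_of_nonneg_ae (h₂.mono fun x hx => pow_nonneg hx.1 m)
        (by fun_prop), h m]
  have hpoly : ∀ p : Polynomial ℝ, ∫ x, p.eval x ∂μ₁ = ∫ x, p.eval x ∂μ₂ := by
    intro p
    simp only [Polynomial.eval_eq_sum_range]
    rw [integral_finsetSum _ fun i _ => hint μ₁ h₁ _ (by fun_prop),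
      integral_finsetSum _ fun i _ => hint μ₂ h₂ _ (by fun_prop)]
    simp only [integral_const_mul, hpow]
  refine ext_of_forall_integral_eq_of_IsFiniteMeasure fun f => ?_
  have hb : ∀ ε > 0, |∫ x, f x ∂μ₁ - ∫ x, f x ∂μ₂| ≤ ε * (μ₁.real univ + μ₂.real univ) := by
    intro ε hε
    -- Weierstrass approximation; both measures give the polynomial the same integral.
    obtain ⟨p, hp⟩ := exists_polynomial_near_of_continuousOn 0 1 f f.continuous.continuousOn ε hε
    have key : ∀ (μ : Measure ℝ) [IsFiniteMeasure μ], (∀ᵐ x ∂μ, x ∈ Icc (0 : ℝ) 1) →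
        |∫ x, f x ∂μ - ∫ x, p.eval x ∂μ| ≤ ε * μ.real univ := by
      intro μ _ hμ
      rw [← integral_sub (hint μ hμ _ f.continuous) (hint μ hμ _ p.continuous)]
      have hbd : ∀ᵐ x ∂μ, ‖f x - p.eval x‖ ≤ ε := hμ.mono fun x hx => by
        rw [norm_sub_rev]; exact (hp x hx).le
      exact norm_integral_le_of_norm_le_const hbd
    have k1 := abs_le.1 (key μ₁ h₁)
    have k2 := abs_le.1 (key μ₂ h₂)
    rw [hpoly p] at k1
    rw [abs_le]
    constructor <;> linarith [k1.1, k1.2, k2.1, k2.2]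
  have hz : |∫ x, f x ∂μ₁ - ∫ x, f x ∂μ₂| ≤ 0 := by
    refine le_of_forall_pos_le_add fun δ hδ => ?_
    have hC : 0 ≤ μ₁.real univ + μ₂.real univ := by positivity
    refine (hb (δ / (μ₁.real univ + μ₂.real univ + 1)) (by positivity)).trans ?_
    rw [zero_add, div_mul_eq_mul_div, div_le_iff₀ (by positivity)]
    nlinarith
  exact sub_eq_zero.1 (abs_eq_zero.1 (le_antisymm hz (abs_nonneg _)))

/-! ### Stochastic domination for nondegenerate programs -/

namespace ConvexProgram

/-- The beta distribution with parameters `M + 1 - n` and `n - k`, read as the Dirac mass at `1` if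
`k = n`. -/
noncomputable def padMeasure (n M k : ℕ) : Measure ℝ :=
  if k = n then Measure.dirac 1 else betaMeasure (M + 1 - n) (n - k)

section Pad

variable {n M k : ℕ}

theorem isProbabilityMeasure_padMeasure (hM : n ≤ M) (hk : k ≤ n) :
    IsProbabilityMeasure (padMeasure n M k) := by
  rw [padMeasure]
  split_ifs with h
  · infer_instance
  · have h1 : (n : ℝ) ≤ M := Nat.cast_le.2 hM
    have h2 : (k : ℝ) < n := Nat.cast_lt.2 (lt_of_le_of_ne hk h)
    exact isProbabilityMeasureBeta (by linarith) (by linarith)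

theorem ae_padMeasure_mem : ∀ᵐ x ∂(padMeasure n M k), x ∈ Ioc (0 : ℝ) 1 := by
  rw [padMeasure]
  split_ifs with h
  · refine (mem_ae_iff (s := Ioc (0 : ℝ) 1)).2 ?_
    rw [Measure.dirac_apply' _ measurableSet_Ioc.compl]
    simp
  · exact (ae_betaMeasure_mem _ _).mono fun x hx => ⟨hx.1, hx.2.le⟩

theorem lintegral_pow_padMeasure (hM : n ≤ M) (hk : k ≤ n) (m : ℕ) :
    ∫⁻ x, ENNReal.ofReal (x ^ m) ∂(padMeasure n M k) = moment n m M k := by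
  rw [padMeasure, moment]
  split_ifs with h
  · subst h
    rw [lintegral_dirac' _ (by fun_prop)]
    simp only [one_pow, ENNReal.ofReal_one]
    refine (Finset.prod_eq_one fun j _ => ENNReal.div_self ?_ (by simp)).symm
    exact Nat.cast_ne_zero.2 (by omega)
  · have h1 : (n : ℝ) ≤ M := Nat.cast_le.2 hM
    have h2 : (k : ℝ) < n := Nat.cast_lt.2 (lt_of_le_of_ne hk h)
    rw [lintegral_pow_betaMeasure (by linarith) (by linarith)]
    refine Finset.prod_congr rfl fun j _ => ?_
    have hj : (0 : ℝ) ≤ j := Nat.cast_nonneg j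
    rw [ENNReal.ofReal_div_of_pos (by linarith), ← ENNReal.ofReal_natCast,
      ← ENNReal.ofReal_natCast, Nat.cast_sub (by omega), Nat.cast_sub (by omega)]
    push_cast
    congr 2 <;> ring

end Pad

variable {n : ℕ} {Z : Type*} [MeasurableSpace Z] {P : ConvexProgram n Z} {M : ℕ}
  {ν : Measure Z} [IsProbabilityMeasure ν]

/-- The law of the keep probability is stochastically larger than a beta distribution. -/
theorem Nondegenerate.measure_keep_lt_le (h : P.Nondegenerate ν) (hn : 1 ≤ n) (hM : n ≤ M)
    (t : ℝ) :
    (Measure.pi fun _ : Fin M => ν) {z | (P.keep ν z).toReal < t} ≤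
      betaMeasure (M + 1 - n) n (Iio t) := by
  set pi := Measure.pi fun _ : Fin M => ν with hpi
  have hprob : ∀ k ∈ Finset.range (n + 1), IsProbabilityMeasure (padMeasure n M k) := fun k hk =>
    isProbabilityMeasure_padMeasure hM (by simpa [Nat.lt_succ_iff] using hk)
  have hkm : Measurable fun z : Fin M → Z => (P.keep ν z).toReal := (measurable_keep ν).ennreal_toReal
  have hk0 : ∀ z : Fin M → Z, 0 ≤ (P.keep ν z).toReal := fun z => ENNReal.toReal_nonneg
  have hk1 : ∀ z : Fin M → Z, (P.keep ν z).toReal ≤ 1 := fun z =>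
    ENNReal.toReal_le_of_le_ofReal zero_le_one (by simpa using keep_le_one ν z)
  have hf : Measurable fun x : (Fin M → Z) × ℝ => (P.keep ν x.1).toReal * x.2 :=
    (hkm.comp measurable_fst).mul measurable_snd
  have hS : ∀ k, MeasurableSet {z : Fin M → Z | P.numSupp z = k} := fun k =>
    measurable_numSupp (measurableSet_singleton k)
  -- On the event of exactly `k` support constraints, `keep` is multiplied by an independent
  -- variable with law `padMeasure n M k`. The sum of these measures over `k ≤ n` will turn out to
  -- be the target beta law.
  let L : ℕ → Measure ℝ := fun k => ((pi.restrict {z | P.numSupp z = k}).prod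
    (padMeasure n M k)).map fun x => (P.keep ν x.1).toReal * x.2
  have hle : ∀ᵐ z ∂pi, P.numSupp z < n + 1 := by
    filter_upwards [h.feasible M] with z hz using Nat.lt_succ_of_le (numSupp_le z hz)
  have hpart : ∀ g : ℕ → (Fin M → Z) → ℝ≥0∞, (∀ k, Measurable (g k)) →
      ∑ k ∈ Finset.range (n + 1), ∫⁻ z in {z | P.numSupp z = k}, g k z ∂pi =
        ∫⁻ z, g (P.numSupp z) z ∂pi := by
    intro g hg
    simp only [← lintegral_indicator (hS _)]
    rw [← lintegral_finsetSum _ fun k _ => (hg k).indicator (hS k)]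
    refine lintegral_congr_ae ?_
    filter_upwards [hle] with z hz
    rw [Finset.sum_eq_single (P.numSupp z)]
    · simp [indicator]
    · intro b _ hb
      simp [indicator, hb.symm]
    · simp [hz]
  have hLmom : ∀ k ∈ Finset.range (n + 1), ∀ m : ℕ, ∫⁻ x, ENNReal.ofReal (x ^ m) ∂(L k) =
      ∫⁻ z in {z | P.numSupp z = k}, P.keep ν z ^ m * moment n m M k ∂pi := by
    intro k hk m
    have := hprob k hk
    rw [lintegral_map (by fun_prop) hf,
      lintegral_prod _ (hf.pow_const m).ennreal_ofReal.aemeasurable]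
    refine lintegral_congr fun z => ?_
    simp only [mul_pow, ENNReal.ofReal_mul (pow_nonneg (hk0 z) m)]
    rw [lintegral_const_mul _ (by fun_prop),
      lintegral_pow_padMeasure hM (by simpa [Nat.lt_succ_iff] using hk),
      ENNReal.ofReal_pow (hk0 z),
      ENNReal.ofReal_toReal ((keep_le_one ν z).trans_lt ENNReal.one_lt_top).ne]
  have hLfin : ∀ k ∈ Finset.range (n + 1), IsFiniteMeasure (L k) := by
    intro k hk
    have := hprob k hk
    infer_instance
  have hLmem : ∀ k ∈ Finset.range (n + 1), ∀ᵐ x ∂(L k), x ∈ Icc (0 : ℝ) 1 := by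
    intro k hk
    have := hprob k hk
    refine (ae_map_iff (p := fun x => x ∈ Icc (0 : ℝ) 1) hf.aemeasurable measurableSet_Icc).2 ?_
    filter_upwards [Measure.quasiMeasurePreserving_snd.ae (ae_padMeasure_mem (n := n) (M := M)
      (k := k))] with x hx
    exact ⟨mul_nonneg (hk0 _) hx.1.le, mul_le_one₀ (hk1 _) hx.1.le hx.2⟩
  have hn' : (0 : ℝ) < n := by exact_mod_cast hn
  have hM' : (0 : ℝ) < (M : ℝ) + 1 - n := by
    have : (n : ℝ) ≤ M := Nat.cast_le.2 hM
    linarith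
  have hbeta := isProbabilityMeasureBeta hM' hn'
  have hpad0 : padMeasure n M 0 = betaMeasure (M + 1 - n) n := by
    rw [padMeasure, if_neg (by omega), Nat.cast_zero, sub_zero]
  have hsum : ∑ k ∈ Finset.range (n + 1), L k = betaMeasure (M + 1 - n) n := by
    have : IsFiniteMeasure (∑ k ∈ Finset.range (n + 1), L k) := by
      constructor
      rw [Measure.finsetSum_apply]
      exact ENNReal.sum_lt_top.2 fun k hk => (hLfin k hk).measure_univ_lt_top
    refine Measure.ext_of_moments_Icc ?_ ?_ fun m => ?_
    · rw [ae_iff, Measure.finsetSum_apply]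
      exact Finset.sum_eq_zero fun k hk => ae_iff.1 (hLmem k hk)
    · exact (ae_betaMeasure_mem _ _).mono fun x hx => ⟨hx.1.le, hx.2.le⟩
    · rw [lintegral_finsetSum_measure, Finset.sum_congr rfl fun k hk => hLmom k hk m,
        hpart _ fun k => ((measurable_keep ν).pow_const m).mul_const _,
        lintegral_keep_pow_mul_moment h m hM, ← lintegral_pow_padMeasure hM (Nat.zero_le n), hpad0]
  change pi ((fun z => (P.keep ν z).toReal) ⁻¹' Iio t) ≤ _
  rw [← hsum, Measure.finsetSum_apply, ← lintegral_indicator_one (hkm measurableSet_Iio),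
    ← hpart (fun _ => indicator ((fun z => (P.keep ν z).toReal) ⁻¹' Iio t) 1)
      fun _ => measurable_one.indicator (hkm measurableSet_Iio)]
  refine Finset.sum_le_sum fun k hk => ?_
  have := hprob k hk
  rw [lintegral_indicator_one (hkm measurableSet_Iio), Measure.map_apply hf measurableSet_Iio]
  calc _ = ((pi.restrict {z | P.numSupp z = k}).prod (padMeasure n M k))
        (((fun z => (P.keep ν z).toReal) ⁻¹' Iio t) ×ˢ univ) := by
        rw [Measure.prod_prod, measure_univ, mul_one]
    _ ≤ _ := by
      -- The padding factor is at most `1`, so the product is below `t` whenever `keep` is.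
      refine measure_mono_ae ?_
      filter_upwards [Measure.quasiMeasurePreserving_snd.ae (ae_padMeasure_mem (n := n) (M := M)
        (k := k))] with x hx hxt
      exact (mul_le_of_le_one_right (hk0 x.1) hx.2).trans_lt hxt.1

end ConvexProgram

/-! ### Perturbation of an arbitrary program -/

/-- Lower semicontinuity of the mass, by continuity from below along the sets of points that lie in
every `A k` from index `m` on. The perturbation argument needs only this one-sided limit. -/
theorem eventually_lt_measureReal {α : Type*} [MeasurableSpace α] {ρ : Measure α}
    [IsFiniteMeasure ρ] {B : Set α} {A : ℕ → Set α}
    (h : ∀ᵐ y ∂ρ, y ∈ B → ∀ᶠ k in Filter.atTop, y ∈ A k) {c : ℝ} (hc : c < ρ.real B) :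
    ∀ᶠ k in Filter.atTop, c < ρ.real (A k) := by
  let C : ℕ → Set α := fun m => {y | ∀ k, m ≤ k → y ∈ A k}
  have hmono : Monotone C := fun m m' hm y hy k hk => hy k (hm.trans hk)
  have hlim : Filter.Tendsto (fun m => ρ.real (C m)) Filter.atTop (nhds (ρ.real (⋃ m, C m))) :=
    (ENNReal.tendsto_toReal (by finiteness)).comp (tendsto_measure_iUnion_atTop hmono)
  have hB : ρ.real B ≤ ρ.real (⋃ m, C m) := by
    refine ENNReal.toReal_mono (by finiteness) (measure_mono_ae ?_)
    filter_upwards [h] with y hy hyB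
    obtain ⟨m, hm⟩ := Filter.eventually_atTop.1 (hy hyB)
    exact mem_iUnion.2 ⟨m, hm⟩
  filter_upwards [hlim.eventually_const_lt (hc.trans_le hB)] with m hm
  exact hm.trans_le (measureReal_mono fun y hy => hy m le_rfl)

namespace ConvexProgram

variable {n : ℕ} {Q : Type*} [MeasurableSpace Q] (P : ConvexProgram n Q) {M : ℕ}

theorem toReal_keep {Z : Type*} [MeasurableSpace Z] {P : ConvexProgram n Z} (ν : Measure Z)
    [IsProbabilityMeasure ν] (z : Fin M → Z) :
    (P.keep ν z).toReal = 1 - ν.real {y | P.Raises z y} :=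
  probReal_compl_eq_one_sub (measurableSet_raises_right z)

/-- The program whose constraints are relaxed by `δ` times a label and whose objective is
made strictly convex. -/
noncomputable def perturb (δ : ℝ) (hδ : 0 < δ) : ConvexProgram n (Q × ℝ) where
  dom := P.dom
  obj θ := P.obj θ + δ * ‖θ‖ ^ 2
  -- With labels in `[0, 1]` the change only relaxes constraints, so feasibility is kept; the
  -- randomness of the label is what destroys ties.
  spec θ z := P.spec θ z.1 - δ * z.2
  convex_dom := P.convex_dom
  compact_dom := P.compact_dom
  convex_obj := P.convex_obj.add
    (((convexOn_norm convex_univ).pow (fun _ _ => norm_nonneg _) 2).smul hδ.le)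
  continuous_obj := P.continuous_obj.add (by fun_prop)
  convex_spec z := (P.convex_spec z.1).sub (concaveOn_const _ convex_univ)
  continuous_spec z := (P.continuous_spec z.1).sub continuous_const
  measurable_spec θ := ((P.measurable_spec θ).comp measurable_fst).sub (by fun_prop)

/-- The law of a constraint with a uniformly distributed label. -/
noncomputable def labelLaw (μ : Measure Q) : Measure (Q × ℝ) :=
  μ.prod (volume.restrict (Icc 0 1))

instance : IsProbabilityMeasure (volume.restrict (Icc (0 : ℝ) 1)) := ⟨by simp⟩

instance (μ : Measure Q) [IsProbabilityMeasure μ] : IsProbabilityMeasure (labelLaw μ) := by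
  unfold labelLaw; infer_instance

theorem measurePreserving_fst_labelLaw {μ : Measure Q} :
    MeasurePreserving Prod.fst (labelLaw μ) μ :=
  measurePreserving_fst

theorem ae_labelLaw_snd {μ : Measure Q} : ∀ᵐ y ∂(labelLaw μ), y.2 ∈ Icc (0 : ℝ) 1 :=
  Measure.quasiMeasurePreserving_snd.ae (ae_restrict_mem measurableSet_Icc)

variable {P} {μ : Measure Q} [IsProbabilityMeasure μ] {δ : ℝ} {hδ : 0 < δ}

theorem measurePreserving_fst_pi :
    MeasurePreserving (fun (z : Fin M → Q × ℝ) i => (z i).1)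
      (Measure.pi fun _ => labelLaw μ) (Measure.pi fun _ => μ) :=
  measurePreserving_pi _ _ fun _ => measurePreserving_fst_labelLaw

theorem ae_pi_labelLaw_snd :
    ∀ᵐ z ∂(Measure.pi fun _ : Fin M => labelLaw μ), ∀ i, (z i).2 ∈ Icc (0 : ℝ) 1 :=
  ae_all_iff.2 fun i =>
    (measurePreserving_eval (fun _ : Fin M => labelLaw μ) i).quasiMeasurePreserving.ae
      ae_labelLaw_snd

theorem ok_subset_ok_perturb {y : Q × ℝ} (hy : 0 ≤ y.2) : P.ok y.1 ⊆ (P.perturb δ hδ).ok y := by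
  intro θ hθ
  have h1 : P.spec θ y.1 ≤ 0 := hθ
  have h2 := mul_nonneg hδ.le hy
  change P.spec θ y.1 - δ * y.2 ≤ 0
  linarith

theorem feas_subset_feas_perturb {z : Fin M → Q × ℝ} (hz : ∀ i, 0 ≤ (z i).2) :
    P.feas (fun i => (z i).1) ⊆ (P.perturb δ hδ).feas z :=
  fun _ hθ => ⟨hθ.1, fun i => ok_subset_ok_perturb (hz i) (hθ.2 i)⟩

/-- By the parallelogram law, the midpoint of two distinct minimisers would have a strictly smaller
objective. -/
theorem uniqueMin_perturb {A : Set (EuclideanSpace ℝ (Fin n))} (hA : Convex ℝ A) :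
    (P.perturb δ hδ).UniqueMin A := by
  intro θ hθ η hη hvθ hvη
  have hmid : (1 / 2 : ℝ) • θ + (1 / 2 : ℝ) • η ∈ A :=
    hA hθ hη (by norm_num) (by norm_num) (by norm_num)
  have h1 := val_le (P := P.perturb δ hδ) hmid
  have hobj : (P.perturb δ hδ).obj θ = (P.perturb δ hδ).obj η :=
    EReal.coe_eq_coe_iff.1 (hvθ.symm.trans hvη)
  rw [hvθ, EReal.coe_le_coe_iff] at h1
  have h2 := P.convex_obj.2 (mem_univ θ) (mem_univ η) (by norm_num : (0 : ℝ) ≤ 1 / 2)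
    (by norm_num : (0 : ℝ) ≤ 1 / 2) (by norm_num)
  have h3 : ‖(1 / 2 : ℝ) • θ + (1 / 2 : ℝ) • η‖ ^ 2 =
      (‖θ‖ ^ 2 + ‖η‖ ^ 2) / 2 - ‖θ - η‖ ^ 2 / 4 := by
    rw [← smul_add, norm_smul, mul_pow, norm_sub_sq_real, norm_add_sq_real]
    norm_num
    ring
  simp only [perturb, smul_eq_mul] at h1 h2 hobj
  rw [h3] at h1
  have h4 : δ * ‖θ - η‖ ^ 2 ≤ 0 := by nlinarith
  have h5 : ‖θ - η‖ ^ 2 ≤ 0 := by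
    by_contra! h; exact absurd h4 (not_le.2 (mul_pos hδ h))
  have h6 : ‖θ - η‖ = 0 := by
    have := sq_nonneg ‖θ - η‖
    exact pow_eq_zero_iff (two_ne_zero) |>.1 (le_antisymm h5 this)
  exact sub_eq_zero.1 (norm_eq_zero.1 h6)

/-- Relaxing a constraint that raises the value strictly lowers the raised value. -/
theorem val_perturb_lt {A : Set (EuclideanSpace ℝ (Fin n))} (hA : Convex ℝ A) (hAc : IsCompact A)
    {q : Q} {u u' : ℝ} (hu : u < u') {v : EReal} (hv : v < ⊤) (h : (P.perturb δ hδ).val A < v)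
    (he : (P.perturb δ hδ).val (A ∩ (P.perturb δ hδ).ok (q, u)) = v) :
    (P.perturb δ hδ).val (A ∩ (P.perturb δ hδ).ok (q, u')) < v := by
  set R := P.perturb δ hδ with hR
  have hne : (A ∩ R.ok (q, u)).Nonempty := nonempty_of_val_lt (he ▸ hv)
  obtain ⟨θ, ⟨hθA, hθ⟩, hθv⟩ := exists_val_eq (P := R) (hAc.inter_right (isClosed_ok _)) hne
  obtain ⟨a, haA, ha⟩ := exists_of_val_lt h
  have hve : v = R.obj θ := he.symm.trans hθv
  rw [hve, EReal.coe_lt_coe_iff] at ha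
  have hθs : P.spec θ q - δ * u ≤ 0 := hθ
  have hgap : 0 < δ * (u' - u) := mul_pos hδ (by linarith)
  -- Move from the minimiser `θ` a little towards the better point `a`: `t` is small enough for the
  -- relaxation `δ * (u' - u)` to absorb the loss in the constraint. The `+ 1` in the witness avoids
  -- division by zero.
  obtain ⟨t, ht0, ht1, ht⟩ : ∃ t : ℝ, 0 < t ∧ t ≤ 1 ∧
      t * (P.spec a q - δ * u) ≤ δ * (u' - u) := by
    refine ⟨min 1 (δ * (u' - u) / (|P.spec a q - δ * u| + 1)), ?_, min_le_left _ _, ?_⟩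
    · exact lt_min one_pos (by positivity)
    · have hpos : 0 < |P.spec a q - δ * u| + 1 := by positivity
      have h0 : 0 ≤ min 1 (δ * (u' - u) / (|P.spec a q - δ * u| + 1)) :=
        le_min zero_le_one (by positivity)
      calc _ ≤ min 1 (δ * (u' - u) / (|P.spec a q - δ * u| + 1)) * (|P.spec a q - δ * u| + 1) :=
            mul_le_mul_of_nonneg_left (by linarith [le_abs_self (P.spec a q - δ * u)]) h0
        _ ≤ δ * (u' - u) / (|P.spec a q - δ * u| + 1) * (|P.spec a q - δ * u| + 1) :=
            mul_le_mul_of_nonneg_right (min_le_right _ _) hpos.le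
        _ = _ := by field_simp
  have hmem : (1 - t) • θ + t • a ∈ A := hA hθA haA (by linarith) ht0.le (by ring)
  have hs := (P.convex_spec q).2 (mem_univ θ) (mem_univ a) (by linarith : 0 ≤ 1 - t) ht0.le
    (by ring)
  have ho := R.convex_obj.2 (mem_univ θ) (mem_univ a) (by linarith : 0 ≤ 1 - t) ht0.le
    (by ring)
  simp only [smul_eq_mul] at hs ho
  have hok : (1 - t) • θ + t • a ∈ R.ok (q, u') := by
    change P.spec _ q - δ * u' ≤ 0
    nlinarith
  have hin : (1 - t) • θ + t • a ∈ A ∩ R.ok (q, u') := ⟨hmem, hok⟩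
  refine (val_le hin).trans_lt ?_
  rw [hve, EReal.coe_lt_coe_iff]
  nlinarith

/-- For a fixed `q`, degeneracy pins the value with the label `u` to a number that does not depend
on `u`, while a larger label strictly lowers that value. So at most one label is degenerate, and a
point is Lebesgue-null. -/
theorem nondegenerate_perturb
    (hf : ∀ M, ∀ᵐ z ∂(Measure.pi fun _ : Fin M => μ), (P.feas z).Nonempty) :
    (P.perturb δ hδ).Nondegenerate (labelLaw μ) where
  feasible M := by
    filter_upwards [measurePreserving_fst_pi.quasiMeasurePreserving.ae (hf M),
      ae_pi_labelLaw_snd (μ := μ)] with z hz hu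
    exact hz.mono (feas_subset_feas_perturb fun i => (hu i).1)
  unique M z := uniqueMin_perturb (convex_feas z)
  nondegenerate M k := by
    filter_upwards [measurePreserving_fst_pi.quasiMeasurePreserving.ae (hf M),
      ae_pi_labelLaw_snd (μ := μ)] with w hw hu
    have hw' : ((P.perturb δ hδ).feas w).Nonempty :=
      hw.mono (feas_subset_feas_perturb fun i => (hu i).1)
    have hm : MeasurableSet {y | (P.perturb δ hδ).Degenerate k y w} :=
      measurable_prodMk_right (measurableSet_degenerate k)
    simp only [ae_iff, not_not]
    rw [labelLaw, Measure.measure_prod_null hm]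
    refine Filter.Eventually.of_forall fun q => ?_
    refine Set.Subsingleton.measure_zero (fun u hu u' hu' => ?_) _
    have aux : ∀ u u' : ℝ, u < u' → (P.perturb δ hδ).Degenerate k (q, u) w →
        ¬ (P.perturb δ hδ).Degenerate k (q, u') w := fun u u' hlt hd hd' =>
      (val_perturb_lt (convex_feasOff w k) (isCompact_feasOff w k) hlt (val_lt_top hw')
        hd.2.2 hd.2.1).ne hd'.2.1
    rcases lt_trichotomy u u' with h | h | h
    · exact absurd hu' (aux _ _ h hu)
    · exact h
    · exact absurd hu (aux _ _ h hu')

/-- A constraint that raises the optimal value still does so after small perturbations. -/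
theorem eventually_raises_perturb {d : ℕ → ℝ} (hd : ∀ k, 0 < d k)
    (hlim : Filter.Tendsto d Filter.atTop (nhds 0)) {z : Fin M → Q × ℝ} {y : Q × ℝ}
    (hz : ∀ i, (z i).2 ∈ Icc (0 : ℝ) 1) (hw : (P.feas fun i => (z i).1).Nonempty)
    (h : P.Raises (fun i => (z i).1) y.1) :
    ∀ᶠ k in Filter.atTop, (P.perturb (d k) (hd k)).Raises z y := by
  by_contra hcon
  rw [Filter.not_eventually] at hcon
  obtain ⟨φ, hφ, hφr⟩ := Filter.extraction_of_frequently_atTop hcon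
  obtain ⟨θ₀, hθ₀, hv₀⟩ := exists_val_eq (P := P) (isCompact_feas _) hw
  -- Along a subsequence on which `y` does not raise the perturbed value, minimisers satisfy every
  -- constraint up to `O(d)` and do no worse than `θ₀` up to `O(d)`. A limit point satisfies `y` in
  -- the original program at no extra cost, a contradiction.
  have hex : ∀ k, ∃ θ ∈ P.dom, (∀ i, P.spec θ (z i).1 ≤ d (φ k) * (z i).2) ∧
      P.spec θ y.1 ≤ d (φ k) * y.2 ∧ P.obj θ ≤ P.obj θ₀ + d (φ k) * ‖θ₀‖ ^ 2 := by
    intro k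
    set R := P.perturb (d (φ k)) (hd (φ k)) with hR
    have h0 : θ₀ ∈ R.feas z := feas_subset_feas_perturb (fun i => (hz i).1) hθ₀
    have hle : R.val (R.feas z ∩ R.ok y) ≤ R.obj θ₀ := by
      rw [not_raises_iff.1 (hφr k)]; exact val_le h0
    obtain ⟨θ, hθ, hθv⟩ := exists_val_eq (P := R) ((isCompact_feas z).inter_right (isClosed_ok y))
      (nonempty_of_val_lt (hle.trans_lt (EReal.coe_lt_top _)))
    rw [hθv, EReal.coe_le_coe_iff] at hle
    refine ⟨θ, hθ.1.1, fun i => sub_nonpos.1 (hθ.1.2 i), sub_nonpos.1 hθ.2, ?_⟩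
    have : P.obj θ + d (φ k) * ‖θ‖ ^ 2 ≤ P.obj θ₀ + d (φ k) * ‖θ₀‖ ^ 2 := hle
    have := mul_nonneg (hd (φ k)).le (sq_nonneg ‖θ‖)
    linarith
  choose θ hθd hθs hθy hθo using hex
  obtain ⟨a, ha, ψ, hψ, hlimθ⟩ := P.compact_dom.tendsto_subseq hθd
  have hdl : ∀ c, Filter.Tendsto (fun k => d (φ (ψ k)) * c) Filter.atTop (nhds 0) := fun c => by
    simpa using ((hlim.comp hφ.tendsto_atTop).comp hψ.tendsto_atTop).mul_const c
  have hmem : a ∈ P.feas (fun i => (z i).1) ∩ P.ok y.1 :=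
    ⟨⟨ha, fun i => le_of_tendsto_of_tendsto' (((P.continuous_spec _).tendsto a).comp hlimθ)
      (hdl (z i).2) fun k => hθs (ψ k) i⟩,
      le_of_tendsto_of_tendsto' (((P.continuous_spec _).tendsto a).comp hlimθ)
      (hdl y.2) fun k => hθy (ψ k)⟩
  have hobj : P.obj a ≤ P.obj θ₀ := le_of_tendsto_of_tendsto'
    ((P.continuous_obj.tendsto a).comp hlimθ)
    (by simpa using (hdl (‖θ₀‖ ^ 2)).const_add (P.obj θ₀)) fun k => hθo (ψ k)
  have h1 := (val_le (P := P) hmem).trans (EReal.coe_le_coe_iff.2 hobj)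
  rw [← hv₀] at h1
  exact absurd h (not_lt.2 h1)

/-- For every problem that is almost surely feasible, the keep probability is stochastically larger
than a beta distribution. -/
theorem measure_keep_lt_le (hn : 1 ≤ n) (hM : n ≤ M)
    (hf : ∀ M, ∀ᵐ z ∂(Measure.pi fun _ : Fin M => μ), (P.feas z).Nonempty) (t : ℝ) :
    (Measure.pi fun _ : Fin M => μ).real {z | (P.keep μ z).toReal < t} ≤
      (betaMeasure (M + 1 - n) n).real (Iio t) := by
  have hn' : (0 : ℝ) < n := by exact_mod_cast hn
  have hM' : (0 : ℝ) < (M : ℝ) + 1 - n := by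
    have : (n : ℝ) ≤ M := Nat.cast_le.2 hM
    linarith
  have hbeta := isProbabilityMeasureBeta hM' hn'
  let d : ℕ → ℝ := fun k => 1 / ((k : ℝ) + 1)
  have hd : ∀ k, 0 < d k := fun k => by positivity
  have hlim : Filter.Tendsto d Filter.atTop (nhds 0) := tendsto_one_div_add_atTop_nhds_zero_nat
  have hset : MeasurableSet {z : Fin M → Q | (P.keep μ z).toReal < t} :=
    measurableSet_lt (measurable_keep μ).ennreal_toReal measurable_const
  have hpre := (measurePreserving_fst_pi (M := M) (μ := μ)).measureReal_preimage
    hset.nullMeasurableSet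
  rw [← hpre]
  -- A strict failure of the bound would persist for some small perturbation. Semicontinuity enters
  -- twice: for the set of raising constraints, at fixed samples, and for the set of samples.
  by_contra! hlt
  obtain ⟨k, hk⟩ := (eventually_lt_measureReal (ρ := Measure.pi fun _ : Fin M => labelLaw μ)
    (A := fun k => {z | ((P.perturb (d k) (hd k)).keep (labelLaw μ) z).toReal < t}) (by
      filter_upwards [measurePreserving_fst_pi.quasiMeasurePreserving.ae (hf M),
        ae_pi_labelLaw_snd (μ := μ)] with z hz hu hzt
      have hzt : (P.keep μ fun i => (z i).1).toReal < t := hzt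
      simp only [toReal_keep] at hzt ⊢
      rw [← measurePreserving_fst_labelLaw.measureReal_preimage
        (measurableSet_raises_right _).nullMeasurableSet] at hzt
      have := eventually_lt_measureReal (ρ := labelLaw μ)
        (B := Prod.fst ⁻¹' {y | P.Raises (fun i => (z i).1) y})
        (A := fun k => {y | (P.perturb (d k) (hd k)).Raises z y}) (c := 1 - t)
        (Filter.Eventually.of_forall fun y hy => eventually_raises_perturb hd hlim hu hz hy)
        (by linarith)
      filter_upwards [this] with k hk
      linarith) hlt).exists
  have hle := ENNReal.toReal_mono (by finiteness)
    ((nondegenerate_perturb (δ := d k) (hδ := hd k) hf).measure_keep_lt_le hn hM t)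
  exact absurd hk (not_lt.2 hle)

end ConvexProgram

/-! ### Stochastic order on the line -/

section StochasticOrder

theorem IsUpperSet.eq_Ici_of_isClosed {S : Set ℝ} (hS : IsUpperSet S) (hc : IsClosed S) :
    S = ∅ ∨ S = univ ∨ ∃ t, S = Ici t := by
  rcases S.eq_empty_or_nonempty with h | hne
  · exact Or.inl h
  refine Or.inr ?_
  by_cases hb : BddBelow S
  · refine Or.inr ⟨sInf S, Subset.antisymm (fun x hx => csInf_le hb hx) fun x hx => ?_⟩
    exact hS hx (hc.csInf_mem hne hb)
  · refine Or.inl (eq_univ_of_forall fun x => ?_)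
    obtain ⟨y, hy, hyx⟩ := not_bddBelow_iff.1 hb x
    exact hS hyx.le hy

/-- Layer cake: superlevel sets of a continuous monotone function are empty, everything, or closed
upper half-lines. -/
theorem lintegral_le_of_stochastic_le {D K : Measure ℝ} [IsProbabilityMeasure D]
    [IsProbabilityMeasure K] (h : ∀ t, D (Ici t) ≤ K (Ici t)) {f : ℝ → ℝ} (hf : Continuous f)
    (hm : Monotone f) (h0 : ∀ x, 0 ≤ f x) :
    ∫⁻ x, ENNReal.ofReal (f x) ∂D ≤ ∫⁻ x, ENNReal.ofReal (f x) ∂K := by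
  rw [lintegral_eq_lintegral_meas_le D (Filter.Eventually.of_forall h0) hf.aemeasurable,
    lintegral_eq_lintegral_meas_le K (Filter.Eventually.of_forall h0) hf.aemeasurable]
  refine lintegral_mono fun s => ?_
  have hup : IsUpperSet {x | s ≤ f x} := fun x y hxy hx => le_trans hx (hm hxy)
  rcases hup.eq_Ici_of_isClosed (isClosed_le continuous_const hf) with h' | h' | ⟨t, h'⟩
  · rw [h']; simp
  · rw [h']; simp
  · rw [h']; exact h t

/-- The mean is the integral of the tail over `t > 0`, so ordered tails with the same finite
integral agree almost everywhere. Monotonicity and left continuity then give agreement at every `t`.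
-/
theorem Measure.eq_of_stochastic_le {D K : Measure ℝ} [IsProbabilityMeasure D]
    [IsProbabilityMeasure K] (h : ∀ t, D (Ici t) ≤ K (Ici t))
    (hD : ∀ᵐ x ∂D, x ∈ Icc (0 : ℝ) 1) (hK : ∀ᵐ x ∂K, x ∈ Icc (0 : ℝ) 1)
    (hmean : ∫⁻ x, ENNReal.ofReal x ∂K = ∫⁻ x, ENNReal.ofReal x ∂D) : D = K := by
  have hfin : ∫⁻ x, ENNReal.ofReal x ∂D ≠ ∞ := by
    refine ne_top_of_le_ne_top (b := 1) (by simp) ?_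
    calc ∫⁻ x, ENNReal.ofReal x ∂D ≤ ∫⁻ _, 1 ∂D :=
          lintegral_mono_ae (hD.mono fun x hx => by simpa using hx.2)
      _ = 1 := by simp
  have e1 := lintegral_eq_lintegral_meas_le D (hD.mono fun x hx => hx.1) aemeasurable_id'
  have e2 := lintegral_eq_lintegral_meas_le K (hK.mono fun x hx => hx.1) aemeasurable_id'
  have hanti : Antitone fun t => K (Ici t) := fun s t hst => measure_mono (Ici_subset_Ici.2 hst)
  have hae : (fun t => D (Ici t)) =ᵐ[volume.restrict (Ioi 0)] fun t => K (Ici t) :=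
    ae_eq_of_ae_le_of_lintegral_le (Filter.Eventually.of_forall h) (by rw [e1] at hfin; exact hfin)
      hanti.measurable.aemeasurable (by rw [e1, e2] at hmean; exact hmean.le)
  refine Measure.ext_of_Ici D K fun t => ?_
  rcases le_or_gt t 0 with ht | ht
  · have key : ∀ ρ : Measure ℝ, IsProbabilityMeasure ρ → (∀ᵐ x ∂ρ, x ∈ Icc (0 : ℝ) 1) →
        ρ (Ici t) = 1 := fun ρ hρ hx =>
      (prob_compl_eq_zero_iff measurableSet_Ici).1 (mem_ae_iff.1 (hx.mono fun x hx => ht.trans hx.1))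
    rw [key D inferInstance hD, key K inferInstance hK]
  · refine le_antisymm (h t) ?_
    have hlim : D (Ici t) = ⨅ k : ℕ, D (Ici (t - 1 / ((k : ℝ) + 1))) := by
      rw [← Antitone.measure_iInter]
      · congr 1
        ext x
        simp only [mem_Ici, mem_iInter, tsub_le_iff_right]
        refine ⟨fun hx k => hx.trans (le_add_of_nonneg_right (by positivity)), fun hx => ?_⟩
        exact ge_of_tendsto' (by simpa using
          (tendsto_one_div_add_atTop_nhds_zero_nat (𝕜 := ℝ)).const_add x) hx
      · intro k l hkl
        exact Ici_subset_Ici.2 (sub_le_sub_left (Nat.one_div_le_one_div hkl) t)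
      · exact fun k => measurableSet_Ici.nullMeasurableSet
      · exact ⟨0, by finiteness⟩
    rw [hlim]
    refine le_iInf fun k => ?_
    have hk : (0 : ℝ) < 1 / ((k : ℝ) + 1) := by positivity
    have hlt : max 0 (t - 1 / ((k : ℝ) + 1)) < t := max_lt ht (by linarith)
    -- A nonempty interval just left of `t` is not null, so it contains a point where the tails
    -- agree.
    have hex : ∃ s ∈ Ioo (max 0 (t - 1 / ((k : ℝ) + 1))) t, D (Ici s) = K (Ici s) := by
      by_contra! hcon
      have hnull : volume (Ioo (max 0 (t - 1 / ((k : ℝ) + 1))) t) = 0 := by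
        rw [Filter.EventuallyEq, ae_restrict_iff' measurableSet_Ioi] at hae
        refine measure_mono_null (fun s hs => ?_) (ae_iff.1 hae)
        exact fun hs' => hcon s hs (hs' ((le_max_left _ _).trans_lt hs.1))
      rw [Real.volume_Ioo, ENNReal.ofReal_eq_zero] at hnull
      linarith
    obtain ⟨s, hs, hse⟩ := hex
    calc K (Ici t) ≤ K (Ici s) := hanti hs.2.le
      _ = D (Ici s) := hse.symm
      _ ≤ _ := measure_mono (Ici_subset_Ici.2 ((le_max_right _ _).trans hs.1.le))

end StochasticOrder

/-! ### The exact beta law under full support -/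

namespace ConvexProgram

variable {n : ℕ} {Q : Type*} [MeasurableSpace Q] {P : ConvexProgram n Q} {M : ℕ}
  {μ : Measure Q} [IsProbabilityMeasure μ]

/-- The law of the keep probability. -/
noncomputable def keepLaw (P : ConvexProgram n Q) (μ : Measure Q) (M : ℕ) : Measure ℝ :=
  (Measure.pi fun _ : Fin M => μ).map fun z => (P.keep μ z).toReal

theorem measurable_toReal_keep : Measurable fun z : Fin M → Q => (P.keep μ z).toReal :=
  (measurable_keep μ).ennreal_toReal

instance : IsProbabilityMeasure (P.keepLaw μ M) :=
  Measure.isProbabilityMeasure_map measurable_toReal_keep.aemeasurable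

theorem toReal_keep_mem (z : Fin M → Q) : (P.keep μ z).toReal ∈ Icc (0 : ℝ) 1 :=
  ⟨ENNReal.toReal_nonneg, ENNReal.toReal_le_of_le_ofReal zero_le_one (by simpa using keep_le_one μ z)⟩

theorem ae_keepLaw_mem : ∀ᵐ x ∂(P.keepLaw μ M), x ∈ Icc (0 : ℝ) 1 :=
  (ae_map_iff (p := fun x => x ∈ Icc (0 : ℝ) 1) measurable_toReal_keep.aemeasurable
    measurableSet_Icc).2 (Filter.Eventually.of_forall toReal_keep_mem)

theorem ofReal_toReal_keep (z : Fin M → Q) : ENNReal.ofReal (P.keep μ z).toReal = P.keep μ z :=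
  ENNReal.ofReal_toReal ((keep_le_one μ z).trans_lt ENNReal.one_lt_top).ne

theorem isProbabilityMeasure_beta (hn : 1 ≤ n) (hM : n ≤ M) :
    IsProbabilityMeasure (betaMeasure (M + 1 - n) n) := by
  have : (n : ℝ) ≤ M := Nat.cast_le.2 hM
  exact isProbabilityMeasureBeta (by linarith) (by exact_mod_cast hn)

theorem keepLaw_Iio_le (hn : 1 ≤ n) (hM : n ≤ M)
    (hf : ∀ M, ∀ᵐ z ∂(Measure.pi fun _ : Fin M => μ), (P.feas z).Nonempty) (t : ℝ) :
    P.keepLaw μ M (Iio t) ≤ betaMeasure (M + 1 - n) n (Iio t) := by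
  have := isProbabilityMeasure_beta hn hM
  rw [keepLaw, Measure.map_apply measurable_toReal_keep measurableSet_Iio]
  exact (ENNReal.toReal_le_toReal (by finiteness) (by finiteness)).1 (measure_keep_lt_le hn hM hf t)

theorem le_keepLaw_Ici (hn : 1 ≤ n) (hM : n ≤ M)
    (hf : ∀ M, ∀ᵐ z ∂(Measure.pi fun _ : Fin M => μ), (P.feas z).Nonempty) (t : ℝ) :
    betaMeasure (M + 1 - n) n (Ici t) ≤ P.keepLaw μ M (Ici t) := by
  have := isProbabilityMeasure_beta hn hM
  rw [← compl_Iio, prob_compl_eq_one_sub measurableSet_Iio, prob_compl_eq_one_sub measurableSet_Iio]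
  exact tsub_le_tsub_left (keepLaw_Iio_le hn hM hf t) 1

/-- If the problem with one more sample is fully supported, then the keep probability has a beta
distribution. -/
theorem keepLaw_eq_of_succ (hn : 1 ≤ n) (hM : n ≤ M)
    (hf : ∀ M, ∀ᵐ z ∂(Measure.pi fun _ : Fin M => μ), (P.feas z).Nonempty)
    (hs : ∀ᵐ z ∂(Measure.pi fun _ : Fin (M + 1) => μ), P.numSupp z = n) :
    P.keepLaw μ M = betaMeasure (M + 1 - n) n := by
  have := isProbabilityMeasure_beta hn hM
  have hM' : (n : ℝ) ≤ M := Nat.cast_le.2 hM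
  have hn' : (0 : ℝ) < n := by exact_mod_cast hn
  refine (Measure.eq_of_stochastic_le (le_keepLaw_Ici hn hM hf)
    ((ae_betaMeasure_mem _ _).mono fun x hx => ⟨hx.1.le, hx.2.le⟩) ae_keepLaw_mem ?_).symm
  -- With constant weights the recursion computes the mean of `keep` for `M` samples: `(M + 1 - n) /
  -- (M + 1)`, the mean of the beta law.
  have key := lintegral_mul_keep (P := P) (ν := μ) (M := M) (φ := fun _ => 1) measurable_const
    (ψ := fun _ => 1) fun _ => by simp
  have hR : ∫⁻ z, 1 * ((M + 1 - P.numSupp z : ℕ) : ℝ≥0∞) ∂(Measure.pi fun _ : Fin (M + 1) => μ) =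
      ((M + 1 - n : ℕ) : ℝ≥0∞) := by
    rw [lintegral_congr_ae (g := fun _ => ((M + 1 - n : ℕ) : ℝ≥0∞))
      (hs.mono fun z hz => by simp only [hz, one_mul])]
    simp
  rw [hR] at key
  have hb := lintegral_pow_betaMeasure (a := M + 1 - n) (b := n) (by linarith) hn' 1
  simp only [pow_one, Finset.prod_range_one, Nat.cast_zero, add_zero, sub_add_cancel] at hb
  rw [keepLaw, lintegral_map (by fun_prop) measurable_toReal_keep, hb]
  simp only [ofReal_toReal_keep, one_mul] at key ⊢
  rw [ENNReal.ofReal_div_of_pos (by positivity), ENNReal.eq_div_iff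
    (by rw [Ne, ENNReal.ofReal_eq_zero, not_le]; positivity) (by finiteness)]
  convert key using 2
  · rw [← ENNReal.ofReal_natCast]; push_cast; rfl
  · rw [← ENNReal.ofReal_natCast, Nat.cast_sub (by omega)]; push_cast; rfl

/-- The beta law of the keep probability passes to a fully supported problem with one more
sample. -/
theorem keepLaw_succ_eq (hn : 1 ≤ n) (hM : n ≤ M)
    (hf : ∀ M, ∀ᵐ z ∂(Measure.pi fun _ : Fin M => μ), (P.feas z).Nonempty)
    (hs : ∀ᵐ z ∂(Measure.pi fun _ : Fin (M + 1) => μ), P.numSupp z = n) :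
    P.keepLaw μ (M + 1) = betaMeasure ((M + 1 : ℕ) + 1 - n) n := by
  have hlaw := keepLaw_eq_of_succ hn hM hf hs
  have := isProbabilityMeasure_beta (M := M + 1) hn (by omega)
  have hM' : (n : ℝ) ≤ M := Nat.cast_le.2 hM
  have hn' : (0 : ℝ) < n := by exact_mod_cast hn
  have hMn : (0 : ℝ) < M + 1 - n := by linarith
  have hm : ∀ M' t, Measurable fun z : Fin M' → Q =>
      ((fun z => (P.keep μ z).toReal) ⁻¹' Iio t).indicator (1 : (Fin M' → Q) → ℝ≥0∞) z :=
    fun M' t => measurable_one.indicator (measurable_toReal_keep measurableSet_Iio)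
  -- The reverse of the general bound. Inserting a harmless constraint can only lower `keep`, so the
  -- recursion may be applied to the indicator of `keep < t` as an inequality; full support makes
  -- the factor `M + 1 - numSupp` constant.
  have hge : ∀ t, betaMeasure ((M + 1 : ℕ) + 1 - n) n (Iio t) ≤ P.keepLaw μ (M + 1) (Iio t) := by
    intro t
    have key := lintegral_mul_keep_le (P := P) (ν := μ) (M := M) (hm (M + 1) t)
      (ψ := ((fun z => (P.keep μ z).toReal) ⁻¹' Iio t).indicator 1) fun j w y hr => by
        by_cases h : (P.keep μ w).toReal < t
        · have h' : (P.keep μ (j.insertNth y w : Fin (M + 1) → Q)).toReal < t :=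
            (ENNReal.toReal_mono ((keep_le_one μ w).trans_lt ENNReal.one_lt_top).ne
              (keep_insertNth_le μ j hr)).trans_lt h
          simp [indicator, h, h']
        · simp [indicator, h]
    have hR : ∫⁻ z, ((fun z => (P.keep μ z).toReal) ⁻¹' Iio t).indicator 1 z *
        ((M + 1 - P.numSupp z : ℕ) : ℝ≥0∞) ∂(Measure.pi fun _ : Fin (M + 1) => μ) =
        ((M + 1 - n : ℕ) : ℝ≥0∞) * P.keepLaw μ (M + 1) (Iio t) := by
      rw [keepLaw, Measure.map_apply measurable_toReal_keep measurableSet_Iio,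
        ← lintegral_indicator_one (measurable_toReal_keep measurableSet_Iio),
        ← lintegral_const_mul _ (hm (M + 1) t)]
      refine lintegral_congr_ae (hs.mono fun z hz => ?_)
      simp only [hz, mul_comm]
    -- The factor `keep` weights the beta law for `M` samples by `x`, which shifts its first
    -- parameter by one and so produces the law for `M + 1` samples.
    have hL : ∫⁻ w, ((fun z => (P.keep μ z).toReal) ⁻¹' Iio t).indicator 1 w * P.keep μ w
        ∂(Measure.pi fun _ : Fin M => μ) = ENNReal.ofReal ((M + 1 - n) / (M + 1)) *
          betaMeasure ((M + 1 : ℕ) + 1 - n) n (Iio t) := by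
      have h1 := setLIntegral_pow_betaMeasure (a := M + 1 - n) (b := n) hMn hn' 1 0
        (measurableSet_Iio (a := t))
      simp only [pow_one, pow_zero, mul_one, Nat.cast_zero, add_zero, Nat.cast_one] at h1
      have h2 : beta ((M : ℝ) + 1 - n + 1) n / beta ((M : ℝ) + 1 - n) n = (M + 1 - n) / (M + 1) := by
        have := (beta_pos hMn hn').ne'
        rw [beta_add_one_left hMn hn', mul_div_assoc, div_self this, mul_one, sub_add_cancel]
      have h3 : ((M + 1 : ℕ) : ℝ) + 1 - n = M + 1 - n + 1 := by push_cast; ring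
      rw [h3, ← h2, ← h1, ← hlaw, keepLaw, ← lintegral_indicator measurableSet_Iio,
        lintegral_map (ENNReal.measurable_ofReal.indicator measurableSet_Iio)
          measurable_toReal_keep]
      refine lintegral_congr fun w => ?_
      by_cases h : (P.keep μ w).toReal < t <;> simp [indicator, h, ofReal_toReal_keep]
    rw [hR, hL, ← mul_assoc] at key
    have hc : ((M + 1 : ℕ) : ℝ≥0∞) * ENNReal.ofReal ((M + 1 - n) / (M + 1)) =
        ((M + 1 - n : ℕ) : ℝ≥0∞) := by
      rw [← ENNReal.ofReal_natCast, ← ENNReal.ofReal_natCast,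
        ← ENNReal.ofReal_mul (by positivity), Nat.cast_sub (by omega)]
      congr 1
      push_cast
      field_simp
    rw [hc] at key
    exact (ENNReal.mul_le_mul_iff_right (Nat.cast_ne_zero.2 (by omega)) (by simp)).1 key
  refine Measure.ext_of_Ici _ _ fun t => ?_
  rw [← compl_Iio, prob_compl_eq_one_sub measurableSet_Iio, prob_compl_eq_one_sub measurableSet_Iio,
    le_antisymm (keepLaw_Iio_le hn (by omega) hf t) (hge t)]

end ConvexProgram

/-! ### Scenario problems as convex programs -/

namespace ScenarioData

variable {n : ℕ} {Q : Type*} [MeasurableSpace Q] {p : ScenarioData n Q} {M : ℕ}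

/-- A scenario problem, as a convex program. -/
noncomputable def Standing.program (hp : p.Standing) : ConvexProgram n Q where
  dom := p.dom
  obj := p.obj
  spec := p.spec
  convex_dom := hp.convex_dom
  compact_dom := hp.compact_dom
  convex_obj := (innerSL ℝ p.cost).toLinearMap.convexOn convex_univ
  continuous_obj := (innerSL ℝ p.cost).continuous
  convex_spec := hp.convex_spec
  continuous_spec q := continuousOn_univ.1 ((hp.convex_spec q).continuousOn isOpen_univ)
  measurable_spec := hp.measurable_spec

variable (hp : p.Standing)

theorem feasible_univ (ω : Fin M → Q) : p.feasible ω Finset.univ = hp.program.feas ω := by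
  ext θ
  simp only [feasible, ConvexProgram.feas, Finset.mem_univ, true_implies]
  rfl

theorem feasible_erase (ω : Fin M → Q) (j : Fin M) :
    p.feasible ω (Finset.univ.erase j) = hp.program.feasOff ω j := by
  ext θ
  simp only [feasible, ConvexProgram.feasOff, Finset.mem_erase, Finset.mem_univ, and_true]
  rfl

/-- The real infimum of the empty set is `0`, the extended one is `⊤`; they agree here because the
set is nonempty and compact. -/
theorem val_eq_sInf {A : Set (EuclideanSpace ℝ (Fin n))} (hA : IsCompact A) (hne : A.Nonempty) :
    hp.program.val A = (sInf (p.obj '' A) : ℝ) := by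
  obtain ⟨θ, hθ, hv⟩ := ConvexProgram.exists_val_eq (P := hp.program) hA hne
  rw [hv]
  congr 1
  refine le_antisymm (le_csInf (hne.image _) ?_) (csInf_le ⟨p.obj θ, ?_⟩ ⟨θ, hθ, rfl⟩)
  all_goals
    rintro _ ⟨η, hη, rfl⟩
    exact EReal.coe_le_coe_iff.1 (hv ▸ ConvexProgram.val_le (P := hp.program) hη)

theorem isOptimal_iff (ω : Fin M → Q) (θ : EuclideanSpace ℝ (Fin n)) :
    p.IsOptimal ω θ ↔ θ ∈ hp.program.feas ω ∧
      hp.program.val (hp.program.feas ω) = hp.program.obj θ := by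
  rw [IsOptimal, feasible_univ hp]
  refine and_congr_right fun hθ => ⟨fun h => ?_, fun h η hη => ?_⟩
  · exact le_antisymm (ConvexProgram.val_le hθ)
      (le_iInf₂ fun η hη => EReal.coe_le_coe_iff.2 (h η hη))
  · exact EReal.coe_le_coe_iff.1 (h ▸ ConvexProgram.val_le (P := hp.program) hη)

theorem isSupport_iff {ω : Fin M → Q} (hω : (hp.program.feas ω).Nonempty) (j : Fin M) :
    p.IsSupport ω j ↔ hp.program.Supp ω j := by
  rw [IsSupport, optValue, optValue, ConvexProgram.Supp, feasible_univ hp, feasible_erase hp,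
    val_eq_sInf hp (ConvexProgram.isCompact_feas ω) hω,
    val_eq_sInf hp (ConvexProgram.isCompact_feasOff ω j)
      (hω.mono (ConvexProgram.feas_subset_feasOff ω j)), EReal.coe_lt_coe_iff]

theorem numSupp_eq {ω : Fin M → Q} (hω : (hp.program.feas ω).Nonempty) :
    hp.program.numSupp ω = {j | p.IsSupport ω j}.ncard := by
  classical
  simp only [isSupport_iff hp hω]
  rw [ConvexProgram.numSupp, Set.ncard_eq_toFinset_card', Set.toFinset_ofPred]

theorem spec_solution_pos_iff {ω : Fin M → Q} (hω : ∃! θ, p.IsOptimal ω θ) (q : Q) :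
    0 < p.spec (p.solution ω) q ↔ hp.program.Raises ω q := by
  have hopt : p.IsOptimal ω (p.solution ω) := by
    rw [solution, dif_pos hω.exists]; exact hω.exists.choose_spec
  have h := (isOptimal_iff hp ω _).1 hopt
  refine (ConvexProgram.raises_iff_spec_pos (P := hp.program) (fun θ hθ η hη hvθ hvη => ?_)
    h.1 h.2 q).symm
  exact hω.unique ((isOptimal_iff hp ω θ).2 ⟨hθ, hvθ⟩) ((isOptimal_iff hp ω η).2 ⟨hη, hvη⟩)

variable {μ : Measure Q}

theorem UniquelySolvable.ae_feas (h : p.UniquelySolvable μ M) :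
    ∀ᵐ ω ∂(Measure.pi fun _ : Fin M => μ), (hp.program.feas ω).Nonempty := by
  filter_upwards [h] with ω hω
  obtain ⟨θ, hθ, -⟩ := hω
  exact ⟨θ, ((isOptimal_iff hp ω θ).1 hθ).1⟩

theorem FullySupported.numSupp_eq (h : p.FullySupported μ M)
    (hf : ∀ᵐ ω ∂(Measure.pi fun _ : Fin M => μ), (hp.program.feas ω).Nonempty) :
    ∀ᵐ ω ∂(Measure.pi fun _ : Fin M => μ), hp.program.numSupp ω = n := by
  filter_upwards [h, hf] with ω hω hne
  rw [ScenarioData.numSupp_eq hp hne, hω]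

variable [IsProbabilityMeasure μ]

theorem violation_solution {ω : Fin M → Q} (hω : ∃! θ, p.IsOptimal ω θ) :
    p.violation μ (p.solution ω) = 1 - (hp.program.keep μ ω).toReal := by
  rw [violation, ConvexProgram.toReal_keep, sub_sub_cancel]
  simp only [spec_solution_pos_iff hp hω]

variable {N : ℕ}

theorem ae_feas (hN : n ≤ N) (hsol : p.UniquelySolvable μ N)
    (hsol' : N = n → p.UniquelySolvable μ (n + 1)) (M : ℕ) :
    ∀ᵐ ω ∂(Measure.pi fun _ : Fin M => μ), (hp.program.feas ω).Nonempty := by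
  rcases hN.eq_or_lt with h | h
  · exact ConvexProgram.ae_feas_of_le le_rfl ((hsol' h.symm).ae_feas hp) M
  · exact ConvexProgram.ae_feas_of_le h (hsol.ae_feas hp) M

/-- For `N > n` the law is first found for `N - 1` samples and then carried up to `N`. For `N = n`
the predecessor would have fewer than `n` samples, so full support at `n + 1` is used instead. -/
theorem keepLaw_eq_betaMeasure (hn : 1 ≤ n) (hN : n ≤ N) (hsol : p.UniquelySolvable μ N)
    (hsol' : N = n → p.UniquelySolvable μ (n + 1)) (hfs : p.FullySupported μ N)
    (hfs' : N = n → p.FullySupported μ (n + 1)) :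
    hp.program.keepLaw μ N = betaMeasure (N + 1 - n) n := by
  have hf := ae_feas hp hN hsol hsol'
  rcases hN.eq_or_lt with h | h
  · subst h
    exact ConvexProgram.keepLaw_eq_of_succ hn le_rfl hf ((hfs' rfl).numSupp_eq hp (hf _))
  · obtain ⟨M, rfl⟩ : ∃ M, N = M + 1 := ⟨N - 1, by omega⟩
    exact ConvexProgram.keepLaw_succ_eq hn (by omega) hf (hfs.numSupp_eq hp (hf _))

end ScenarioData

/-! ### Binomial distribution functions and beta mixtures -/

section Binomial

/-- The number of samples that fall in `S` has a binomial distribution. -/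
theorem measure_pi_ncard_le {Q : Type*} [MeasurableSpace Q] (μ : Measure Q)
    [IsProbabilityMeasure μ] {S : Set Q} (hS : MeasurableSet S) {m k : ℕ} (hk : k ≤ m) :
    (Measure.pi fun _ : Fin m => μ).real {s | {i | s i ∈ S}.ncard ≤ k} =
      binomialCDF m k (μ.real S) := by
  classical
  -- Sorting samples by the exact set `T` of indices that fall in `S` splits the event into disjoint
  -- product boxes.
  let box : Finset (Fin m) → Set (Fin m → Q) := fun T => univ.pi fun i => if i ∈ T then S else Sᶜ
  have hmem : ∀ T s, s ∈ box T ↔ (Finset.univ.filter fun i => s i ∈ S) = T := by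
    intro T s
    simp only [box, mem_univ_pi, Finset.ext_iff, Finset.mem_filter, Finset.mem_univ, true_and]
    refine forall_congr' fun i => ?_
    by_cases h : i ∈ T <;> simp [h]
  have hset : {s : Fin m → Q | {i | s i ∈ S}.ncard ≤ k} =
      ⋃ T ∈ (Finset.univ.filter fun T : Finset (Fin m) => T.card ≤ k), box T := by
    ext s
    have hc : {i | s i ∈ S}.ncard = (Finset.univ.filter fun i => s i ∈ S).card := by
      rw [Set.ncard_eq_toFinset_card', Set.toFinset_ofPred]
    simp [hmem, hc]
  have hbox : ∀ T, (Measure.pi fun _ : Fin m => μ).real (box T) =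
      μ.real S ^ T.card * (1 - μ.real S) ^ (m - T.card) := by
    intro T
    rw [Measure.real, Measure.pi_pi, ENNReal.toReal_prod, ← Finset.prod_mul_prod_compl T]
    rw [Finset.prod_congr rfl fun i hi => by rw [if_pos hi],
      Finset.prod_congr (s₁ := Tᶜ) rfl fun i hi => by rw [if_neg (Finset.mem_compl.1 hi)]]
    rw [Finset.prod_const, Finset.prod_const, Finset.card_compl, Fintype.card_fin,
      ← probReal_compl_eq_one_sub hS]
    rfl
  rw [hset, measureReal_biUnion_finset]
  · simp only [hbox]
    rw [Finset.sum_filter, ← Finset.powerset_univ,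
      Finset.sum_powerset_apply_card
        (fun j => if j ≤ k then μ.real S ^ j * (1 - μ.real S) ^ (m - j) else 0),
      Finset.card_univ, Fintype.card_fin, binomialCDF]
    simp only [smul_ite, smul_zero]
    rw [← Finset.sum_filter]
    refine Finset.sum_congr ?_ fun j _ => by rw [nsmul_eq_mul, mul_assoc]
    ext j; simp only [Finset.mem_filter, Finset.mem_range]; omega
  · intro T _ T' _ hne
    refine Set.disjoint_left.2 fun s hs hs' => hne ?_
    rw [← (hmem T s).1 hs, ← (hmem T' s).1 hs']
  · exact fun T _ => MeasurableSet.univ_pi fun i => by split_ifs; exacts [hS, hS.compl]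

theorem continuous_binomialCDF (m k : ℕ) : Continuous (binomialCDF m k) := by
  unfold binomialCDF; fun_prop

theorem binomialCDF_nonneg (m k : ℕ) {v : ℝ} (h0 : 0 ≤ v) (h1 : v ≤ 1) : 0 ≤ binomialCDF m k v :=
  Finset.sum_nonneg fun i _ => by
    have : 0 ≤ 1 - v := by linarith
    positivity

theorem binomialCDF_self (m : ℕ) (v : ℝ) : binomialCDF m m v = 1 := by
  have h := add_pow v (1 - v) m
  rw [add_sub_cancel, one_pow] at h
  rw [h, binomialCDF]
  exact Finset.sum_congr rfl fun i _ => by ring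

/-- Read off from the beta integral, whose upper limit decreases in `v`. The case `k = m` is
separate because a beta parameter would be `0`. -/
theorem binomialCDF_anti {m k : ℕ} (hk : k ≤ m) {v v' : ℝ} (h0 : 0 ≤ v) (h : v ≤ v')
    (h1 : v' ≤ 1) : binomialCDF m k v' ≤ binomialCDF m k v := by
  rcases hk.eq_or_lt with rfl | hk
  · rw [binomialCDF_self, binomialCDF_self]
  · have hkm : (k : ℝ) < m := Nat.cast_lt.2 hk
    have hb : (0 : ℝ) < k + 1 := by positivity
    have := isProbabilityMeasureBeta (α := m - k) (β := k + 1) (by linarith) hb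
    rw [binomialCDF_eq_Fbeta hk (h0.trans h) h1, binomialCDF_eq_Fbeta hk h0 (h.trans h1),
      Fbeta_eq_measure (by linarith) hb (by linarith),
      Fbeta_eq_measure (by linarith) hb (by linarith)]
    exact measureReal_mono (Iio_subset_Iio (by linarith))

/-- Integral of the binomial distribution function against a beta distribution. -/
theorem setLIntegral_binomialCDF {n N No k : ℕ} (hn : 1 ≤ n) (hN : n ≤ N) (hk : k ≤ No)
    {s : Set ℝ} (hs : MeasurableSet s) :
    ∫⁻ x in s, ENNReal.ofReal (binomialCDF No k (1 - x)) ∂(betaMeasure (N + 1 - n) n) =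
      ∑ i ∈ Finset.range (k + 1), ENNReal.ofReal (betaBinomial No n (N + 1 - n) i) *
        betaMeasure (N + 1 - n + (No - i : ℕ)) (n + i) s := by
  have hn' : (0 : ℝ) < n := by exact_mod_cast hn
  have ha : (0 : ℝ) < (N : ℝ) + 1 - n := by
    have : (n : ℝ) ≤ N := Nat.cast_le.2 hN
    linarith
  have hae : ∀ᵐ x ∂((betaMeasure (N + 1 - n) n).restrict s), x ∈ Ioo (0 : ℝ) 1 :=
    ae_restrict_of_ae (ae_betaMeasure_mem _ _)
  rw [lintegral_congr_ae (g := fun x => ∑ i ∈ Finset.range (k + 1), ENNReal.ofReal (No.choose i) *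
    ENNReal.ofReal (x ^ (No - i) * (1 - x) ^ i)), lintegral_finsetSum]
  · refine Finset.sum_congr rfl fun i hi => ?_
    have hi : i ≤ No := by rw [Finset.mem_range] at hi; omega
    rw [lintegral_const_mul _ (by fun_prop), setLIntegral_pow_betaMeasure ha hn' _ _ hs,
      ← mul_assoc, ← ENNReal.ofReal_mul (by positivity), betaBinomial, beta_symm (i + n : ℝ),
      beta_symm (n : ℝ), Nat.cast_sub hi]
    congr 5 <;> ring
  · exact fun i _ => by fun_prop
  · filter_upwards [hae] with x hx
    have h1 : 0 ≤ 1 - x := by linarith [hx.2]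
    have h0 := hx.1.le
    rw [binomialCDF, ENNReal.ofReal_sum_of_nonneg]
    · refine Finset.sum_congr rfl fun i _ => ?_
      rw [← ENNReal.ofReal_mul (by positivity), sub_sub_cancel]
      congr 1; ring
    · intro i _
      rw [sub_sub_cancel]; positivity

theorem betaBinomial_pos {n N No i : ℕ} (hn : 1 ≤ n) (hN : n ≤ N) (hi : i ≤ No) :
    0 < betaBinomial No n (N + 1 - n) i := by
  have hn' : (0 : ℝ) < n := by exact_mod_cast hn
  have ha : (0 : ℝ) < (N : ℝ) + 1 - n := by
    have : (n : ℝ) ≤ N := Nat.cast_le.2 hN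
    linarith
  have hi' : (i : ℝ) ≤ No := Nat.cast_le.2 hi
  have hc : (0 : ℝ) < No.choose i := Nat.cast_pos.2 (Nat.choose_pos hi)
  exact mul_pos hc (div_pos (beta_pos (by positivity) (by linarith)) (beta_pos hn' ha))

theorem betaTail_eq {n N : ℕ} (hn : 1 ≤ n) (hN : n ≤ N) (ε : ℝ) :
    betaTail n ε N = binomialCDF N (n - 1) ε := by
  have h := binomialCDF_self N ε
  rw [betaTail, sub_eq_iff_eq_add]
  refine h.symm.trans ?_
  rw [binomialCDF, binomialCDF, Nat.sub_add_cancel hn,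
    ← Finset.sum_range_add_sum_Ico _ (by omega : n ≤ N + 1)]
  rfl

theorem betaTail_eq_measure {n N : ℕ} (hn : 1 ≤ n) (hN : n ≤ N) {ε : ℝ} (h0 : 0 ≤ ε)
    (h1 : ε ≤ 1) : betaTail n ε N = (betaMeasure (N + 1 - n) n).real (Iio (1 - ε)) := by
  have hn' : (0 : ℝ) < n := by exact_mod_cast hn
  have ha : (0 : ℝ) < (N : ℝ) + 1 - n := by
    have : (n : ℝ) ≤ N := Nat.cast_le.2 hN
    linarith
  rw [betaTail_eq hn hN, binomialCDF_eq_Fbeta (by omega) h0 h1, Nat.cast_sub hn, Nat.cast_one,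
    sub_add_cancel, ← Fbeta_eq_measure ha hn' (by linarith)]
  congr 1; ring

end Binomial

/-! ### Hitting times of independent sequences -/

section HittingTime

variable {X : Type*}

/-- The first time, counted from `1`, at which a sequence enters `A`. -/
noncomputable def hitTime (A : Set X) (x : ℕ → X) : ℕ∞ :=
  ⨅ (k : ℕ) (_ : x k ∈ A ∧ ∀ j < k, x j ∉ A), ((k + 1 : ℕ) : ℕ∞)

theorem hitTime_eq {A : Set X} {x : ℕ → X} {m : ℕ} (hm : x m ∈ A ∧ ∀ j < m, x j ∉ A) :
    hitTime A x = (m + 1 : ℕ) := by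
  refine le_antisymm (iInf₂_le m hm) (le_iInf₂ fun k hk => ?_)
  have : m ≤ k := not_lt.1 fun h => hm.2 k h hk.1
  exact_mod_cast Nat.succ_le_succ this

theorem exists_first_hit {A : Set X} {x : ℕ → X} {j : ℕ} (hj : x j ∈ A) :
    ∃ m ≤ j, x m ∈ A ∧ ∀ i < m, x i ∉ A := by
  classical
  have h : ∃ j, x j ∈ A := ⟨j, hj⟩
  exact ⟨Nat.find h, Nat.find_min' h hj, Nat.find_spec h, fun i hi => Nat.find_min h hi⟩

theorem hitTime_eq_top {A : Set X} {x : ℕ → X} (h : ∀ k, x k ∉ A) : hitTime A x = ⊤ := by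
  simp [hitTime, h]

theorem hitTime_le_iff {A : Set X} {x : ℕ → X} {k : ℕ} :
    hitTime A x ≤ k ↔ ∃ j < k, x j ∈ A := by
  constructor
  · intro h
    by_cases hex : ∃ j, x j ∈ A
    · obtain ⟨j, hj⟩ := hex
      obtain ⟨m, -, hm⟩ := exists_first_hit hj
      rw [hitTime_eq hm] at h
      exact ⟨m, by exact_mod_cast h, hm.1⟩
    · push Not at hex
      rw [hitTime_eq_top hex] at h
      exact absurd h (by simp)
  · rintro ⟨j, hjk, hj⟩
    obtain ⟨m, hmj, hm⟩ := exists_first_hit hj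
    rw [hitTime_eq hm]
    exact_mod_cast (by omega : m + 1 ≤ k)

/-- Pointwise tail-sum formula, also correct when the set is never hit; its integral is a geometric
series. -/
theorem coe_hitTime {A : Set X} (x : ℕ → X) :
    (hitTime A x : ℝ≥0∞) = ∑' k : ℕ, {x : ℕ → X | ∀ j < k, x j ∉ A}.indicator 1 x := by
  by_cases hex : ∃ j, x j ∈ A
  · obtain ⟨j, hj⟩ := hex
    obtain ⟨m, -, hm⟩ := exists_first_hit hj
    rw [hitTime_eq hm, tsum_eq_sum (s := Finset.range (m + 1))]
    · rw [Finset.sum_congr rfl (g := fun _ => (1 : ℝ≥0∞))]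
      · simp
      · intro k hk
        rw [Finset.mem_range] at hk
        have hx : x ∈ {x : ℕ → X | ∀ j < k, x j ∉ A} := fun j hj => hm.2 j (by omega)
        exact indicator_of_mem hx _
    · intro k hk
      rw [Finset.mem_range, not_lt] at hk
      have hx : x ∉ {x : ℕ → X | ∀ j < k, x j ∉ A} := fun h => h m (by omega) hm.1
      exact indicator_of_notMem hx _
  · push Not at hex
    rw [hitTime_eq_top hex, tsum_congr (g := fun _ => (1 : ℝ≥0∞))]
    · simp
    · intro k
      have hx : x ∈ {x : ℕ → X | ∀ j < k, x j ∉ A} := fun j _ => hex j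
      exact indicator_of_mem hx _

variable [MeasurableSpace X] {π : Measure X} [IsProbabilityMeasure π] {A B : Set X}

theorem measurableSet_forall_lt_notMem (hA : MeasurableSet A) (k : ℕ) :
    MeasurableSet {x : ℕ → X | ∀ j < k, x j ∉ A} := by
  have : {x : ℕ → X | ∀ j < k, x j ∉ A} = ⋂ j, ⋂ (_ : j < k), (fun x : ℕ → X => x j) ⁻¹' Aᶜ := by
    ext; simp
  rw [this]
  exact MeasurableSet.iInter fun j => MeasurableSet.iInter fun _ => measurable_pi_apply j hA.compl

theorem measurable_coe_hitTime (hA : MeasurableSet A) :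
    Measurable fun x : ℕ → X => (hitTime A x : ℝ≥0∞) := by
  simp only [coe_hitTime]
  exact Measurable.tsum fun k =>
    measurable_one.indicator (measurableSet_forall_lt_notMem hA k)

theorem measure_forall_lt_notMem (hA : MeasurableSet A) (k : ℕ) :
    Measure.infinitePi (fun _ : ℕ => π) {x | ∀ j < k, x j ∉ A} = π Aᶜ ^ k := by
  have : {x : ℕ → X | ∀ j < k, x j ∉ A} = (Finset.range k : Set ℕ).pi fun _ => Aᶜ := by
    ext; simp [Set.mem_pi]
  rw [this, Measure.infinitePi_pi _ fun _ _ => hA.compl]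
  simp

theorem measure_first_hit (hA : MeasurableSet A) (hB : MeasurableSet B) (k : ℕ) :
    Measure.infinitePi (fun _ : ℕ => π) {x | x k ∈ B ∧ ∀ j < k, x j ∉ A} = π Aᶜ ^ k * π B := by
  have : {x : ℕ → X | x k ∈ B ∧ ∀ j < k, x j ∉ A} =
      (Finset.range (k + 1) : Set ℕ).pi fun j => if j = k then B else Aᶜ := by
    ext x
    simp only [Set.mem_pi, Finset.coe_range, mem_Iio, mem_ofPred_eq]
    constructor
    · rintro ⟨h1, h2⟩ j hj
      split_ifs with h
      · exact h ▸ h1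
      · exact h2 j (by omega)
    · intro h
      refine ⟨by simpa using h k (by omega), fun j hj => ?_⟩
      have := h j (by omega)
      rwa [if_neg (by omega)] at this
  rw [this, Measure.infinitePi_pi _ fun j _ => by split_ifs; exacts [hB, hA.compl],
    Finset.prod_range_succ, if_pos rfl, Finset.prod_congr rfl (g := fun _ => π Aᶜ)]
  · simp
  · intro j hj
    rw [Finset.mem_range] at hj
    rw [if_neg (by omega)]

theorem measurableSet_hit (hA : MeasurableSet A) (hB : MeasurableSet B) :
    MeasurableSet {x : ℕ → X | ∃ k, x k ∈ B ∧ ∀ j < k, x j ∉ A} := by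
  have : {x : ℕ → X | ∃ k, x k ∈ B ∧ ∀ j < k, x j ∉ A} =
      ⋃ k, ((fun x : ℕ → X => x k) ⁻¹' B ∩ {x | ∀ j < k, x j ∉ A}) := by
    ext; simp
  rw [this]
  exact MeasurableSet.iUnion fun k =>
    (measurable_pi_apply k hB).inter (measurableSet_forall_lt_notMem hA k)

/-- A geometric series over the time of the first entry into `A`; `B ⊆ A` makes the events for
different times disjoint. -/
theorem measure_hit (hA : MeasurableSet A) (hB : MeasurableSet B) (hBA : B ⊆ A) :
    Measure.infinitePi (fun _ : ℕ => π) {x | ∃ k, x k ∈ B ∧ ∀ j < k, x j ∉ A} = π B / π A := by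
  have : {x : ℕ → X | ∃ k, x k ∈ B ∧ ∀ j < k, x j ∉ A} =
      ⋃ k, {x | x k ∈ B ∧ ∀ j < k, x j ∉ A} := by
    ext; simp
  rw [this, measure_iUnion]
  · simp only [measure_first_hit hA hB]
    rw [ENNReal.tsum_mul_right, ENNReal.tsum_geometric, prob_compl_eq_one_sub hA,
      ENNReal.sub_sub_cancel ENNReal.one_ne_top prob_le_one, mul_comm, div_eq_mul_inv]
  · intro k l hkl
    refine Set.disjoint_left.2 fun x hx hx' => ?_
    rcases lt_or_gt_of_ne hkl with h | h
    · exact hx'.2 k h (hBA hx.1)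
    · exact hx.2 l h (hBA hx'.1)
  · exact fun k => (measurable_pi_apply k hB).inter (measurableSet_forall_lt_notMem hA k)

theorem lintegral_hitTime (hA : MeasurableSet A) :
    ∫⁻ x, (hitTime A x : ℝ≥0∞) ∂(Measure.infinitePi fun _ : ℕ => π) = (π A)⁻¹ := by
  simp only [coe_hitTime]
  rw [lintegral_tsum fun k =>
    (measurable_one.indicator (measurableSet_forall_lt_notMem hA k)).aemeasurable]
  simp only [lintegral_indicator_one (measurableSet_forall_lt_notMem hA _),
    measure_forall_lt_notMem hA]
  rw [ENNReal.tsum_geometric, prob_compl_eq_one_sub hA,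
    ENNReal.sub_sub_cancel ENNReal.one_ne_top prob_le_one]

theorem measureReal_hitTime_le (hA : MeasurableSet A) (k : ℕ) :
    (Measure.infinitePi fun _ : ℕ => π).real {x | hitTime A x ≤ k} = 1 - (1 - π.real A) ^ k := by
  have : {x : ℕ → X | hitTime A x ≤ k} = {x | ∀ j < k, x j ∉ A}ᶜ := by
    ext; simp [hitTime_le_iff]
  rw [this, probReal_compl_eq_one_sub (measurableSet_forall_lt_notMem hA k), Measure.real,
    measure_forall_lt_notMem hA, ENNReal.toReal_pow, ← probReal_compl_eq_one_sub hA]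
  rfl

end HittingTime

/-! ### The exit probability of one iteration -/

namespace ConvexProgram

variable {n : ℕ} {Q : Type*} [MeasurableSpace Q] (P : ConvexProgram n Q) (N No k : ℕ)

/-- Scenarios and oracle samples for which at most `k` oracle samples raise the optimal value. -/
def exitSet : Set ((Fin N → Q) × (Fin No → Q)) :=
  {x | {i | P.Raises x.1 (x.2 i)}.ncard ≤ k}

variable {P N No k} {μ : Measure Q} [IsProbabilityMeasure μ]

theorem measurableSet_exitSet : MeasurableSet (P.exitSet N No k) := by
  classical
  have hm : Measurable fun x : (Fin N → Q) × (Fin No → Q) => {i | P.Raises x.1 (x.2 i)}.ncard := by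
    have heq : ∀ x : (Fin N → Q) × (Fin No → Q), {i | P.Raises x.1 (x.2 i)}.ncard =
        ∑ i, if P.Raises x.1 (x.2 i) then 1 else 0 := by
      intro x
      rw [Set.ncard_eq_toFinset_card', Set.toFinset_ofPred, Finset.card_filter]
    simp only [heq]
    refine Finset.measurable_sum _ fun i _ => Measurable.ite ?_ measurable_const measurable_const
    have hf : Measurable fun x : (Fin N → Q) × (Fin No → Q) => (x.2 i, x.1) := by fun_prop
    exact hf measurableSet_raises
  exact hm measurableSet_Iic

theorem measurableSet_keep_mem {s : Set ℝ} (hs : MeasurableSet s) :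
    MeasurableSet {x : (Fin N → Q) × (Fin No → Q) | (P.keep μ x.1).toReal ∈ s} :=
  (measurable_toReal_keep.comp measurable_fst) hs

/-- For fixed scenarios the oracle samples that raise the value are counted by a binomial variable
with success probability `1 - keep`; then integrate over the scenarios. -/
theorem measure_exitSet_inter (hk : k ≤ No) {s : Set ℝ} (hs : MeasurableSet s) :
    ((Measure.pi fun _ : Fin N => μ).prod (Measure.pi fun _ : Fin No => μ))
      (P.exitSet N No k ∩ {x | (P.keep μ x.1).toReal ∈ s}) =
      ∫⁻ x in s, ENNReal.ofReal (binomialCDF No k (1 - x)) ∂(P.keepLaw μ N) := by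
  have hm : Measurable fun x => ENNReal.ofReal (binomialCDF No k (1 - x)) :=
    ((continuous_binomialCDF No k).measurable.comp (measurable_const.sub measurable_id)).ennreal_ofReal
  rw [Measure.prod_apply (measurableSet_exitSet.inter (measurableSet_keep_mem hs)),
    ← lintegral_indicator hs, keepLaw, lintegral_map (hm.indicator hs) measurable_toReal_keep]
  refine lintegral_congr fun w => ?_
  by_cases h : (P.keep μ w).toReal ∈ s
  · rw [indicator_of_mem h, toReal_keep, sub_sub_cancel,
      ← measure_pi_ncard_le μ (measurableSet_raises_right w) hk, ofReal_measureReal]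
    congr 1
    ext t
    have : (P.keep μ w).toReal ∈ s := h
    simp [exitSet, this]
  · rw [indicator_of_notMem h]
    have : Prod.mk w ⁻¹' (P.exitSet N No k ∩ {x | (P.keep μ x.1).toReal ∈ s}) = ∅ := by
      ext t; simp [h]
    rw [this, measure_empty]

theorem measure_exitSet (hk : k ≤ No) :
    ((Measure.pi fun _ : Fin N => μ).prod (Measure.pi fun _ : Fin No => μ)) (P.exitSet N No k) =
      ∫⁻ x, ENNReal.ofReal (binomialCDF No k (1 - x)) ∂(P.keepLaw μ N) := by
  have h := measure_exitSet_inter (P := P) (μ := μ) (N := N) hk MeasurableSet.univ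
  simpa using h

end ConvexProgram

/-! ### Beta bounds for the binomial integrals -/

section Bounds

theorem lintegral_binomialCDF {n N No k : ℕ} (hn : 1 ≤ n) (hN : n ≤ N) (hk : k ≤ No) :
    ∫⁻ x, ENNReal.ofReal (binomialCDF No k (1 - x)) ∂(betaMeasure (N + 1 - n) n) =
      ENNReal.ofReal (∑ i ∈ Finset.range (k + 1), betaBinomial No n (N + 1 - n) i) := by
  have hn' : (0 : ℝ) < n := by exact_mod_cast hn
  have hN' : (n : ℝ) ≤ N := Nat.cast_le.2 hN
  have h := setLIntegral_binomialCDF hn hN hk MeasurableSet.univ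
  rw [Measure.restrict_univ] at h
  rw [h, ENNReal.ofReal_sum_of_nonneg fun i hi => (betaBinomial_pos hn hN (by
    rw [Finset.mem_range] at hi; omega)).le]
  refine Finset.sum_congr rfl fun i _ => ?_
  have := isProbabilityMeasureBeta (α := N + 1 - n + (No - i : ℕ)) (β := n + i)
    (by have : (0 : ℝ) ≤ (No - i : ℕ) := Nat.cast_nonneg _; linarith) (by positivity)
  rw [measure_univ, mul_one]

/-- Undoing the floor lowers the first beta parameter and raises the second, and both changes
increase the distribution function. For `ε' = 1` the first parameter would be `0`. -/
theorem binomialCDF_le_Fbeta {No : ℕ} {ε ε' : ℝ} (hε' : 0 ≤ ε') (hε'ε : ε' ≤ ε) (hε : ε ≤ 1)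
    (hNo : 1 ≤ No) (hlt : ε' < 1) :
    binomialCDF No ⌊ε' * No⌋₊ ε ≤ Fbeta ((1 - ε') * No) (ε' * No + 1) (1 - ε) := by
  have hNo' : (0 : ℝ) < No := by exact_mod_cast hNo
  have hk : (⌊ε' * No⌋₊ : ℝ) ≤ ε' * No := Nat.floor_le (by positivity)
  have hkNo : ⌊ε' * No⌋₊ < No := by
    have : (⌊ε' * No⌋₊ : ℝ) < No := hk.trans_lt (by nlinarith)
    exact_mod_cast this
  rw [binomialCDF_eq_Fbeta hkNo (hε'.trans hε'ε) hε]
  exact Fbeta_le_Fbeta (by nlinarith) (by linarith) (by positivity) (by linarith) (by linarith)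
    (by linarith)

/-- The integral is a beta mixture over the oracle count `i`. As `i ≤ ε' * No`, each component is
bounded by the beta law with `ε' * No` in place of `i`. -/
theorem setLIntegral_binomialCDF_le_betaBar {n N No : ℕ} (hn : 1 ≤ n) (hN : n ≤ N)
    {ε ε' : ℝ} (hε' : 0 ≤ ε') (hε'ε : ε' ≤ ε) (hε : ε ≤ 1) :
    ∫⁻ x in Iio (1 - ε), ENNReal.ofReal (binomialCDF No ⌊ε' * No⌋₊ (1 - x))
        ∂(betaMeasure (N + 1 - n) n) ≤
      ENNReal.ofReal (∑ i ∈ Finset.range (⌊ε' * No⌋₊ + 1), betaBinomial No n (N + 1 - n) i) *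
        ENNReal.ofReal (betaBar n ε ε' N No) := by
  have hn' : (0 : ℝ) < n := by exact_mod_cast hn
  have hN' : (n : ℝ) ≤ N := Nat.cast_le.2 hN
  have hkε : (⌊ε' * No⌋₊ : ℝ) ≤ ε' * No := Nat.floor_le (by positivity)
  have hk : ⌊ε' * No⌋₊ ≤ No := by
    have : (⌊ε' * No⌋₊ : ℝ) ≤ No :=
      hkε.trans (mul_le_of_le_one_left (Nat.cast_nonneg _) (hε'ε.trans hε))
    exact_mod_cast this
  rw [setLIntegral_binomialCDF hn hN hk measurableSet_Iio,
    ENNReal.ofReal_sum_of_nonneg fun i hi => (betaBinomial_pos hn hN (by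
      rw [Finset.mem_range] at hi; omega)).le, Finset.sum_mul]
  refine Finset.sum_le_sum fun i hi => mul_le_mul_right ?_ _
  have hik : i ≤ ⌊ε' * No⌋₊ := by rw [Finset.mem_range] at hi; omega
  have hi' : (i : ℝ) ≤ ε' * No := (Nat.cast_le.2 hik).trans hkε
  have h0 : (0 : ℝ) ≤ (1 - ε') * No := mul_nonneg (by linarith) (Nat.cast_nonneg _)
  have hcast : ((No - i : ℕ) : ℝ) = No - i := Nat.cast_sub (hik.trans hk)
  have ha : (0 : ℝ) < N + 1 - n + (No - i : ℕ) := by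
    have : (0 : ℝ) ≤ (No - i : ℕ) := Nat.cast_nonneg _
    linarith
  have hb : (0 : ℝ) < n + i := by positivity
  have := isProbabilityMeasureBeta ha hb
  rw [← ofReal_measureReal, ← Fbeta_eq_measure ha hb (by linarith)]
  refine ENNReal.ofReal_le_ofReal (Fbeta_le_Fbeta ?_ ?_ hb ?_ (by linarith) ?_)
  · linarith
  · rw [hcast]; linarith
  · linarith
  · linarith

end Bounds

/-! ### Bounds for one iteration -/

namespace ConvexProgram

variable {n : ℕ} {Q : Type*} [MeasurableSpace Q] {P : ConvexProgram n Q} {N No : ℕ}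
  {μ : Measure Q} [IsProbabilityMeasure μ]

theorem le_measure_exitSet {k : ℕ} (hn : 1 ≤ n) (hN : n ≤ N) (hk : k ≤ No)
    (hf : ∀ M, ∀ᵐ z ∂(Measure.pi fun _ : Fin M => μ), (P.feas z).Nonempty) :
    ENNReal.ofReal (∑ i ∈ Finset.range (k + 1), betaBinomial No n (N + 1 - n) i) ≤
      ((Measure.pi fun _ : Fin N => μ).prod (Measure.pi fun _ : Fin No => μ))
        (P.exitSet N No k) := by
  have := isProbabilityMeasure_beta hn hN
  rw [← lintegral_binomialCDF hn hN hk, measure_exitSet hk]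
  -- Clamping to the unit interval makes the integrand monotone on the whole line without changing
  -- it where the laws live.
  let f : ℝ → ℝ := fun x => binomialCDF No k (1 - max 0 (min 1 x))
  have hc : ∀ x : ℝ, 0 ≤ 1 - max 0 (min 1 x) ∧ 1 - max 0 (min 1 x) ≤ 1 := fun x =>
    ⟨sub_nonneg.2 (max_le zero_le_one (min_le_left _ _)), sub_le_self _ (le_max_left _ _)⟩
  have hfe : ∀ ρ : Measure ℝ, (∀ᵐ x ∂ρ, x ∈ Icc (0 : ℝ) 1) →
      ∫⁻ x, ENNReal.ofReal (binomialCDF No k (1 - x)) ∂ρ = ∫⁻ x, ENNReal.ofReal (f x) ∂ρ := by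
    intro ρ hρ
    refine lintegral_congr_ae (hρ.mono fun x hx => ?_)
    simp only [f, min_eq_right hx.2, max_eq_right hx.1]
  rw [hfe _ ((ae_betaMeasure_mem _ _).mono fun x hx => ⟨hx.1.le, hx.2.le⟩), hfe _ ae_keepLaw_mem]
  refine lintegral_le_of_stochastic_le (le_keepLaw_Ici hn hN hf)
    ((continuous_binomialCDF No k).comp (by fun_prop)) (fun x y hxy => ?_)
    fun x => binomialCDF_nonneg No k (hc x).1 (hc x).2
  refine binomialCDF_anti hk (hc y).1 ?_ (hc x).2
  exact sub_le_sub_left (max_le_max le_rfl (min_le_min le_rfl hxy)) 1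

theorem measure_exitSet_inter_le (hn : 1 ≤ n) (hN : n ≤ N) (hNo : 1 ≤ No) {ε ε' : ℝ}
    (hε' : 0 ≤ ε') (hε'ε : ε' ≤ ε) (hε : ε ≤ 1)
    (hf : ∀ M, ∀ᵐ z ∂(Measure.pi fun _ : Fin M => μ), (P.feas z).Nonempty) :
    ((Measure.pi fun _ : Fin N => μ).prod (Measure.pi fun _ : Fin No => μ)).real
      (P.exitSet N No ⌊ε' * No⌋₊ ∩ {x | (P.keep μ x.1).toReal ∈ Iio (1 - ε)}) ≤
      Fbeta ((1 - ε') * No) (ε' * No + 1) (1 - ε) * betaTail n ε N := by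
  have hb := isProbabilityMeasure_beta hn hN
  have hk : ⌊ε' * No⌋₊ ≤ No := Nat.floor_le_of_le
    (mul_le_of_le_one_left (Nat.cast_nonneg _) (hε'ε.trans hε))
  -- If `ε' = 1` then `ε = 1`, and no solution is violated with probability above `1`.
  rcases (hε'ε.trans hε).eq_or_lt with h1 | hlt
  · have hε1 : ε = 1 := le_antisymm hε (h1 ▸ hε'ε)
    have hempty : {x : (Fin N → Q) × (Fin No → Q) | (P.keep μ x.1).toReal ∈ Iio (1 - ε)} = ∅ := by
      ext x
      have := (toReal_keep_mem (P := P) (μ := μ) x.1).1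
      simp [hε1]
    rw [hempty, inter_empty, measureReal_empty, hε1, sub_self]
    simp [Fbeta]
  have hF0 : 0 ≤ Fbeta ((1 - ε') * No) (ε' * No + 1) (1 - ε) :=
    (binomialCDF_nonneg _ _ (hε'.trans hε'ε) hε).trans
      (binomialCDF_le_Fbeta hε' hε'ε hε hNo hlt)
  rw [betaTail_eq_measure hn hN (hε'.trans hε'ε) hε, Measure.real,
    measure_exitSet_inter hk measurableSet_Iio]
  refine ENNReal.toReal_le_of_le_ofReal (mul_nonneg hF0 measureReal_nonneg) ?_
  rw [ENNReal.ofReal_mul hF0, ofReal_measureReal]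
  calc _ ≤ ∫⁻ _ in Iio (1 - ε), ENNReal.ofReal (Fbeta ((1 - ε') * No) (ε' * No + 1) (1 - ε))
        ∂(P.keepLaw μ N) := by
        refine setLIntegral_mono_ae' measurableSet_Iio (ae_keepLaw_mem.mono fun x hx hxε => ?_)
        have hxε : x < 1 - ε := hxε
        exact ENNReal.ofReal_le_ofReal ((binomialCDF_anti hk (hε'.trans hε'ε) (by linarith)
          (by linarith [hx.1])).trans (binomialCDF_le_Fbeta hε' hε'ε hε hNo hlt))
    _ = ENNReal.ofReal (Fbeta ((1 - ε') * No) (ε' * No + 1) (1 - ε)) *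
        P.keepLaw μ N (Iio (1 - ε)) := setLIntegral_const _ _
    _ ≤ _ := mul_le_mul_right (keepLaw_Iio_le hn hN hf _) _

end ConvexProgram

/-! ### The algorithm, and the proof of the theorem -/

namespace ScenarioData

variable {n : ℕ} {Q : Type*} [MeasurableSpace Q] {p : ScenarioData n Q} (hp : p.Standing)
  {μ : Measure Q} [IsProbabilityMeasure μ] {N No : ℕ}

theorem oracleTrue_iff {ε' : ℝ} (hε' : 0 ≤ ε') {ω : Fin N → Q} (hω : ∃! θ, p.IsOptimal ω θ)
    (s : Fin No → Q) : p.OracleTrue ε' (p.solution ω) s ↔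
      (ω, s) ∈ hp.program.exitSet N No ⌊ε' * No⌋₊ := by
  rw [OracleTrue]
  simp only [spec_solution_pos_iff hp hω]
  exact (Nat.le_floor_iff (by positivity)).symm

theorem ae_existsUnique (hsol : p.UniquelySolvable μ N) :
    ∀ᵐ x ∂(runLaw μ N No), ∀ k, ∃! θ, p.IsOptimal (x k).1 θ := by
  refine ae_all_iff.2 fun k => ?_
  have h1 := (measurePreserving_eval_infinitePi (fun _ : ℕ =>
    (Measure.pi fun _ : Fin N => μ).prod (Measure.pi fun _ : Fin No => μ)) k).quasiMeasurePreserving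
  exact h1.ae (Measure.quasiMeasurePreserving_fst.ae hsol)

theorem flag_iff {ε' : ℝ} (hε' : 0 ≤ ε') {x : Runs Q N No} {k : ℕ}
    (hx : ∃! θ, p.IsOptimal (x k).1 θ) :
    p.Flag ε' x k ↔ x k ∈ hp.program.exitSet N No ⌊ε' * No⌋₊ := oracleTrue_iff hp hε' hx _

/-- The chosen solution need not be measurable in the samples; almost surely it is unique and the
flag is membership in a measurable set. -/
theorem runningTime_ae_eq {ε' : ℝ} (hε' : 0 ≤ ε') (hsol : p.UniquelySolvable μ N) :
    ∀ᵐ x ∂(runLaw μ N No), p.runningTime ε' x =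
      hitTime (hp.program.exitSet N No ⌊ε' * No⌋₊) x := by
  filter_upwards [ae_existsUnique hsol] with x hx
  simp only [runningTime, ExitsAt, hitTime, flag_iff hp hε' (hx _)]

theorem badExit_ae_eq {ε ε' : ℝ} (hε' : 0 ≤ ε') (hsol : p.UniquelySolvable μ N) :
    p.BadExit μ ε ε' N No =ᵐ[runLaw μ N No]
      {x | ∃ k, x k ∈ hp.program.exitSet N No ⌊ε' * No⌋₊ ∩
        {x | (hp.program.keep μ x.1).toReal ∈ Iio (1 - ε)} ∧
        ∀ j < k, x j ∉ hp.program.exitSet N No ⌊ε' * No⌋₊} := by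
  filter_upwards [ae_existsUnique hsol] with x hx
  refine propext (exists_congr fun k => ?_)
  have hv : ε < p.violation μ (p.iterate x k) ↔
      (hp.program.keep μ (x k).1).toReal < 1 - ε := by
    rw [iterate, violation_solution hp (hx k)]
    constructor <;> intro h <;> linarith
  simp only [ExitsAt, flag_iff hp hε' (hx _), hv]
  exact and_right_comm

end ScenarioData

theorem theorem3 {n : ℕ} (hn : 1 ≤ n) {Q : Type*} [MeasurableSpace Q]
    (μ : Measure Q) [IsProbabilityMeasure μ]
    (p : ScenarioData n Q) (hp : p.Standing)
    (ε ε' : ℝ) (hε' : 0 ≤ ε') (hε'ε : ε' ≤ ε) (hε : ε ≤ 1)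
    (N No : ℕ) (hN : n ≤ N) (hNo : 1 ≤ No)
    (hsol : p.UniquelySolvable μ N)
    (hsol' : N = n → p.UniquelySolvable μ (n + 1)) :
    -- the event and the running time are measurable up to null sets
    (NullMeasurableSet (p.BadExit μ ε ε' N No) (ScenarioData.runLaw μ N No) ∧
      AEMeasurable (fun x : ScenarioData.Runs Q N No => (p.runningTime ε' x : ℝ≥0∞))
        (ScenarioData.runLaw μ N No)) ∧
    -- bounds for a general problem
    ((ScenarioData.runLaw μ N No).real (p.BadExit μ ε ε' N No) ≤
        Fbeta ((1 - ε') * No) (ε' * No + 1) (1 - ε) / (1 - Hone n ε' N No) * betaTail n ε N ∧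
      ∫⁻ x, (p.runningTime ε' x : ℝ≥0∞) ∂(ScenarioData.runLaw μ N No) ≤
        ENNReal.ofReal (1 - Hone n ε' N No)⁻¹ ∧
      ∀ k : ℕ, 1 - Hone n ε' N No ^ k ≤
        (ScenarioData.runLaw μ N No).real {x | p.runningTime ε' x ≤ k}) ∧
    -- bounds and equalities for a fully supported problem
    (p.FullySupported μ N → (N = n → p.FullySupported μ (n + 1)) →
      (ScenarioData.runLaw μ N No).real (p.BadExit μ ε ε' N No) ≤ betaBar n ε ε' N No ∧
      ∫⁻ x, (p.runningTime ε' x : ℝ≥0∞) ∂(ScenarioData.runLaw μ N No) =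
        ENNReal.ofReal (1 - Hone n ε' N No)⁻¹ ∧
      ∀ k : ℕ, (ScenarioData.runLaw μ N No).real {x | p.runningTime ε' x ≤ k} =
        1 - Hone n ε' N No ^ k) := by
  set P := hp.program with hP
  set k₀ := ⌊ε' * No⌋₊ with hk₀
  set π := (Measure.pi fun _ : Fin N => μ).prod (Measure.pi fun _ : Fin No => μ) with hπ
  set A := P.exitSet N No k₀ with hA
  set B := A ∩ {x | (P.keep μ x.1).toReal ∈ Iio (1 - ε)} with hB
  have hk : k₀ ≤ No := Nat.floor_le_of_le
    (mul_le_of_le_one_left (Nat.cast_nonneg _) (hε'ε.trans hε))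
  have hf := ScenarioData.ae_feas hp hN hsol hsol'
  have hAm : MeasurableSet A := ConvexProgram.measurableSet_exitSet
  have hBm : MeasurableSet B := hAm.inter (ConvexProgram.measurableSet_keep_mem measurableSet_Iio)
  set h := ∑ i ∈ Finset.range (k₀ + 1), betaBinomial No n (N + 1 - n) i with hh
  have hH : 1 - Hone n ε' N No = h := by rw [Hone, sub_sub_cancel]
  have hH' : Hone n ε' N No = 1 - h := by rw [← hH, sub_sub_cancel]
  have hpos : 0 < h := Finset.sum_pos (fun i hi => betaBinomial_pos hn hN (by
    rw [Finset.mem_range] at hi; omega)) ⟨0, by simp⟩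
  -- The exit probability of one iteration is at least `1 - Hone n ε' N No`; all three general
  -- bounds use this.
  have hle : ENNReal.ofReal h ≤ π A := ConvexProgram.le_measure_exitSet hn hN hk hf
  have hler : h ≤ π.real A := (ENNReal.ofReal_le_iff_le_toReal (by finiteness)).1 hle
  have hrt := ScenarioData.runningTime_ae_eq (No := No) hp hε' hsol
  have hbad := ScenarioData.badExit_ae_eq (No := No) (ε := ε) hp hε' hsol
  have hPbad : (ScenarioData.runLaw μ N No).real (p.BadExit μ ε ε' N No) = π.real B / π.real A := by
    rw [measureReal_congr hbad, Measure.real, ScenarioData.runLaw,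
      measure_hit hAm hBm inter_subset_left, ENNReal.toReal_div]
    rfl
  have hPtime : ∀ k : ℕ, (ScenarioData.runLaw μ N No).real {x | p.runningTime ε' x ≤ k} =
      1 - (1 - π.real A) ^ k := by
    intro k
    rw [← measureReal_hitTime_le hAm k]
    refine measureReal_congr ?_
    filter_upwards [hrt] with x hx
    exact congrArg (fun t : ℕ∞ => t ≤ (k : ℕ∞)) hx
  have hE : ∫⁻ x, (p.runningTime ε' x : ℝ≥0∞) ∂(ScenarioData.runLaw μ N No) = (π A)⁻¹ := by
    rw [← lintegral_hitTime hAm]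
    exact lintegral_congr_ae (hrt.mono fun x hx => congrArg (fun t : ℕ∞ => (t : ℝ≥0∞)) hx)
  refine ⟨⟨?_, ?_⟩, ⟨?_, ?_, ?_⟩, fun hfs hfs' => ?_⟩
  · exact ((measurableSet_hit hAm hBm).nullMeasurableSet).congr hbad.symm
  · exact ⟨_, measurable_coe_hitTime hAm, hrt.mono fun x hx => congrArg (fun t : ℕ∞ => (t : ℝ≥0∞)) hx⟩
  · have hb := ConvexProgram.measure_exitSet_inter_le hn hN hNo hε' hε'ε hε hf
    rw [hPbad, hH, div_mul_eq_mul_div]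
    exact div_le_div₀ (measureReal_nonneg.trans hb) hb hpos hler
  · rw [hE, hH, ENNReal.ofReal_inv_of_pos hpos]
    exact ENNReal.inv_le_inv.2 hle
  · intro k
    rw [hPtime, hH']
    have h1 : π.real A ≤ 1 := measureReal_le_one
    exact sub_le_sub_left (pow_le_pow_left₀ (by linarith) (by linarith) k) 1
  · have hlaw := ScenarioData.keepLaw_eq_betaMeasure hp hn hN hsol hsol' hfs hfs'
    have hAeq : π A = ENNReal.ofReal h := by
      rw [ConvexProgram.measure_exitSet hk, hlaw, lintegral_binomialCDF hn hN hk]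
    have hAr : π.real A = h := by rw [Measure.real, hAeq, ENNReal.toReal_ofReal hpos.le]
    refine ⟨?_, ?_, ?_⟩
    · have hb0 : 0 ≤ betaBar n ε ε' N No := by
        have hN' : (n : ℝ) ≤ N := Nat.cast_le.2 hN
        have hn' : (0 : ℝ) < n := by exact_mod_cast hn
        have h0 : 0 ≤ (1 - ε') * No := mul_nonneg (by linarith) (Nat.cast_nonneg _)
        rw [betaBar, Fbeta_eq_measure (by linarith) (by positivity) (by linarith)]
        exact measureReal_nonneg
      -- The factor `h` is the exit probability itself under full support, so it cancels in the
      -- quotient.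
      have hb : π B ≤ ENNReal.ofReal h * ENNReal.ofReal (betaBar n ε ε' N No) := by
        rw [ConvexProgram.measure_exitSet_inter hk measurableSet_Iio, hlaw]
        exact setLIntegral_binomialCDF_le_betaBar hn hN hε' hε'ε hε
      rw [← ENNReal.ofReal_mul hpos.le] at hb
      rw [hPbad, hAr, div_le_iff₀ hpos, mul_comm]
      exact ENNReal.toReal_le_of_le_ofReal (mul_nonneg hpos.le hb0) hb
    · rw [hE, hH, hAeq, ENNReal.ofReal_inv_of_pos hpos]
    · intro k
      rw [hPtime, hAr, hH']
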